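/- Let $n\ge 3$ be odd and $a<b$. Let $p_k\in L_1(a,b)$, $k=0,\dots,n-2$, be complex-valued, and let $P_j,Q_j$, $j=0,\dots,n-1$, be complex polynomials of degree less than $n$. Consider the boundary conditions $$(P_j(D)y)(a)+(Q_j(D)y)(b)=0,\qquad j=0,\dots,n-1. \tag{1}$$ Let $d_j=\max(\deg P_j,\deg Q_j)$, and let $a_j,b_j$ be the coefficients of degree $d_j$ of $P_j,Q_j$. Assume that (1) is normalized ($\sum_j d_j$ is minimal among all systems obtained from (1) by invertible linear transformations) and Birkhoff regular; that is, with $\rho=e^{2\pi i/n}$, for both $\nu=\frac{n+1}2$ and $\nu=\frac{n-1}2$ the determinant of the $n\times n$ matrix with entries $a_j\rho^{kd_j}$ for $0\le k<\nu$ and $b_j\rho^{kd_j}$ for $\nu\le k\le n-1$ (row $j$, column $k$) does not vanish. Let $\mathbb L_0$ and $\mathbb L$ be the operators on $[a,b]$ generated by $(-i)^nD^n$ and by $(-i)^nD^n+\sum_{k=0}^{n-2}p_k(x)D^k$, respectively, with the boundary conditions (1), and let $\{\lambda_N^0\}$, $\{\lambda_N\}$ be their eigenvalues. Let $G_0(x,y,\lambda)$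 be the Green function of $\mathbb L_0-\lambda$, where $\lambda$ is not an eigenvalue of $\mathbb L_0$. Let $\mathfrak q$ be a finite complex-valued measure on $[a,b]$ with $\mathfrak q([a,b])=0$ and without atoms at $a$ and $b$. Assume that its distribution function $\mathcal Q(x)=\mathfrak q([a,x])$ is differentiable at $a$ and at $b$ (one-sidedly) and that $\mathcal Q'(a)=\mathcal Q'(b)=0$. For $\ell=1,2,\dots$ let $R_\ell$ be a positive $C^1$ function on the arc $\{w=e^{i\phi}:0\le\phi\le 2\pi/n\}$ with $R_\ell(\rho)=R_\ell(1)$, let $\gamma_\ell$ be the closed contour $\{R_\ell(w)^nw^n\}$, traversed counterclockwise, and let $\Gamma_\ell=\{R_\ell(w)w\}$. Assume that the sequence is acceptable: $R_\ell(1)\to\infty$, and there are constants $c_1,c_2,\delta>0$ such that for all $\ell$ and all $w$ in the arc $$|R_\ell(w)-R_\ell(1)|\le c_1,\qquad \Big|\frac{dR_\ell}{dw}(w)\Big|\le c_2R_\ell(w),$$ and $\Gamma_\ell$ has distance at least $\delta$ from all the points $(\lambda_N^0)^{1/n}$ and $(\lambda_N)^{1/n}$, the roots being taken with argument in $[0,2\pi/n)$.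 Then $$\lim_{\ell\to\infty}\int_{\gamma_\ell}\int_{[a,b]}G_0(x,x,\lambda)\,\mathfrak q(dx)\,d\lambda=0 .$$ -/

import Mathlib

open Set Filter Topology MeasureTheory
open scoped Polynomial

noncomputable section

namespace TraceFormula

/-- The left-hand side `(P(D)y)(a) + (Q(D)y)(b)` of a boundary condition on `[a, b]`. -/
def boundaryForm (a b : ℝ) (P Q : ℂ[X]) (y : ℝ → ℂ) : ℂ :=
  (P.sum fun k c => c * iteratedDerivWithin k y (Icc a b) a) +
    Q.sum fun k c => c * iteratedDerivWithin k y (Icc a b) b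

/-- The order of a boundary condition: the maximum of the degrees of `P` and `Q`. -/
def bcOrder (P Q : ℂ[X]) : ℕ := max P.natDegree Q.natDegree

/-- The system of boundary conditions `(P_j, Q_j)` is normalized: its total order is minimal
among all the systems obtained from it by invertible linear transformations. -/
def IsNormalized {n : ℕ} (P Q : Fin n → ℂ[X]) : Prop :=
  ∀ T : Matrix (Fin n) (Fin n) ℂ, IsUnit T.det →
    ∑ j, bcOrder (P j) (Q j) ≤
      ∑ j, bcOrder (∑ k, Polynomial.C (T j k) * P k) (∑ k, Polynomial.C (T j k) * Q k)

/-- Let `d_j` be the order of the `j`-th condition, let `a_j`, `b_j` be the coefficients of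
`P_j`, `Q_j` at degree `d_j`, and let `ρ = exp (2πi/n)`. The matrix has in its `j`-th row the
entries `a_j ρ ^ (k d_j)` for `k < ν` and `b_j ρ ^ (k d_j)` for `ν ≤ k < n`. -/
def birkhoffMatrix {n : ℕ} (P Q : Fin n → ℂ[X]) (ν : ℕ) : Matrix (Fin n) (Fin n) ℂ :=
  Matrix.of fun j k =>
    (if (k : ℕ) < ν then (P j).coeff (bcOrder (P j) (Q j))
      else (Q j).coeff (bcOrder (P j) (Q j))) *
    Complex.exp (2 * Real.pi * Complex.I / n) ^ ((k : ℕ) * bcOrder (P j) (Q j))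

/-- Birkhoff regularity (of a normalized system). For `0 < arg z < π/n` the exponentials
`exp (i z ρ^k x)` that decay as `|z| → ∞` are those with `k < ⌊(n+1)/2⌋`, and for
`π/n < arg z < 2π/n` those with `k < ⌊n/2⌋`. For odd `n` the two determinants are, up to nonzero
factors, the two extreme coefficients `θ₀`, `θ₁` of the Birkhoff polynomial; for even `n` they
coincide, and both extreme coefficients `θ₋₁`, `θ₁` agree with them up to nonzero factors. -/
def IsBirkhoffRegular {n : ℕ} (P Q : Fin n → ℂ[X]) : Prop :=
  (birkhoffMatrix P Q ((n + 1) / 2)).det ≠ 0 ∧ (birkhoffMatrix P Q (n / 2)).det ≠ 0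

/-- The set of eigenvalues of the operator generated on `[a, b]` by the differential expression
`(-i)^n D^n + ∑_{k ≤ n-2} p_k(x) D^k` and the boundary conditions
`(P_j(D)y)(a) + (Q_j(D)y)(b) = 0`. Eigenfunctions have an absolutely continuous
`(n-1)`-th derivative and satisfy the equation almost everywhere. -/
def eigenvalues (n : ℕ) (a b : ℝ) (p : Fin (n - 1) → ℝ → ℂ) (P Q : Fin n → ℂ[X]) : Set ℂ :=
  {μ | ∃ y : ℝ → ℂ,
    (∃ x ∈ Icc a b, y x ≠ 0) ∧
    ContDiffOn ℝ (n - 1 : ℕ) y (Icc a b) ∧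
    AbsolutelyContinuousOnInterval (iteratedDerivWithin (n - 1) y (Icc a b)) a b ∧
    (∀ᵐ x ∂volume.restrict (Icc a b),
      (-Complex.I) ^ n * iteratedDerivWithin n y (Icc a b) x +
        ∑ k : Fin (n - 1), p k x * iteratedDerivWithin k y (Icc a b) x = μ * y x) ∧
    ∀ j, boundaryForm a b (P j) (Q j) y = 0}

/-- `G` is a Green function on `[a, b]` of the operator `(-i)^n D^n - μ` with the boundary
conditions `(P_j(D)y)(a) + (Q_j(D)y)(b) = 0` (classical definition): it has jointly continuous
derivatives in the first variable up to order `n - 2`; off the diagonal it is `n` times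
continuously differentiable in the first variable and solves the homogeneous equation; its
`(n-1)`-th derivative jumps on the diagonal by the inverse of the leading coefficient; and it
satisfies the boundary conditions. If `μ` is not an eigenvalue, there is exactly one such
function on `[a, b] × [a, b]`. -/
structure IsGreenFunction (n : ℕ) (a b : ℝ) (P Q : Fin n → ℂ[X]) (μ : ℂ)
    (G : ℝ → ℝ → ℂ) : Prop where
  contDiffOn : ∀ ξ ∈ Icc a b, ContDiffOn ℝ (n - 2 : ℕ) (fun x => G x ξ) (Icc a b)
  continuousOn : ∀ k ≤ n - 2, ContinuousOn
    (fun s : ℝ × ℝ => iteratedDerivWithin k (fun x => G x s.2) (Icc a b) s.1)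
    (Icc a b ×ˢ Icc a b)
  contDiffOn_off_diag : ∀ ξ ∈ Ioo a b, ContDiffOn ℝ n (fun x => G x ξ) (Icc a b \ {ξ})
  equation : ∀ ξ ∈ Ioo a b, ∀ x ∈ Icc a b \ {ξ},
    (-Complex.I) ^ n * iteratedDerivWithin n (fun t => G t ξ) (Icc a b) x = μ * G x ξ
  jump : ∀ ξ ∈ Ioo a b, ∃ l r : ℂ,
    Tendsto (iteratedDerivWithin (n - 1) (fun x => G x ξ) (Icc a b)) (𝓝[<] ξ) (𝓝 l) ∧
    Tendsto (iteratedDerivWithin (n - 1) (fun x => G x ξ) (Icc a b)) (𝓝[>] ξ) (𝓝 r) ∧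
    r - l = ((-Complex.I) ^ n)⁻¹
  boundary : ∀ ξ ∈ Ioo a b, ∀ j, boundaryForm a b (P j) (Q j) (fun x => G x ξ) = 0

/-- The Green function `G₀(x, y, μ)` of the operator `(-i)^n D^n - μ` with the given boundary
conditions; it is meaningful for `x, y ∈ [a, b]` and `μ` outside the set of eigenvalues. -/
def greenFunction (n : ℕ) (a b : ℝ) (P Q : Fin n → ℂ[X]) (x y : ℝ) (μ : ℂ) : ℂ :=
  Classical.epsilon (IsGreenFunction n a b P Q μ) x y

/-- The distribution function `x ↦ q([a, x])` of a complex measure on `[a, b]`. -/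
def distributionFunction {a b : ℝ} (q : ComplexMeasure (Icc a b)) (x : ℝ) : ℂ :=
  q {t | (t : ℝ) ≤ x}

/-- The integral of a complex function against a complex measure. -/
def complexIntegral {α : Type*} [MeasurableSpace α] (q : ComplexMeasure α) (f : α → ℂ) : ℂ :=
  VectorMeasure.integral q f (ContinuousLinearMap.mul ℝ ℂ)

/-- The contour `γ = R(w)^n w^n`, where `w = exp (iφ)`, `0 ≤ φ ≤ 2π/n`, and `R` is
written as a function of the angle `φ`. -/
def contour (n : ℕ) (R : ℝ → ℝ) (φ : ℝ) : ℂ :=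
  ((R φ : ℂ) * Complex.exp (φ * Complex.I)) ^ n

/-- The contour integral `∫_γ F(μ) dμ` over `contour n R`, traversed counterclockwise. -/
def contourIntegral (n : ℕ) (R : ℝ → ℝ) (F : ℂ → ℂ) : ℂ :=
  ∫ φ in (0 : ℝ)..(2 * Real.pi / n),
    F (contour n R φ) * derivWithin (contour n R) (Icc 0 (2 * Real.pi / n)) φ

/-- The `n`-th roots, with argument in `[0, 2π/n)`, of the elements of `S`
(for `n ≥ 3`, where such arguments are principal). -/
def sectorRoots (n : ℕ) (S : Set ℂ) : Set ℂ :=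
  {z | z ^ n ∈ S ∧ 0 ≤ z.arg ∧ z.arg < 2 * Real.pi / n}

/-- Acceptable sequences of contours relative to a set `S` of eigenvalues. The radius
functions `R ℓ` are written as functions of the angle `φ ∈ [0, 2π/n]` of `w = exp (iφ)`, so that
`|dR/dw| = |dR/dφ|`. -/
structure IsAcceptable (n : ℕ) (S : Set ℂ) (R : ℕ → ℝ → ℝ) : Prop where
  smooth : ∀ ℓ, ContDiffOn ℝ 1 (R ℓ) (Icc 0 (2 * Real.pi / n))
  closed : ∀ ℓ, R ℓ (2 * Real.pi / n) = R ℓ 0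
  pos : ∀ ℓ, ∀ φ ∈ Icc 0 (2 * Real.pi / n), 0 < R ℓ φ
  tendsto : Tendsto (fun ℓ => R ℓ 0) atTop atTop
  oscillation : ∃ c₁ > 0, ∀ ℓ, ∀ φ ∈ Icc 0 (2 * Real.pi / n), |R ℓ φ - R ℓ 0| ≤ c₁
  slope : ∃ c₂ > 0, ∀ ℓ, ∀ φ ∈ Icc 0 (2 * Real.pi / n),
    |derivWithin (R ℓ) (Icc 0 (2 * Real.pi / n)) φ| ≤ c₂ * R ℓ φ
  separated : ∃ δ > 0, ∀ ℓ, ∀ φ ∈ Icc 0 (2 * Real.pi / n), ∀ z ∈ sectorRoots n S,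
    δ ≤ dist ((R ℓ φ : ℂ) * Complex.exp (φ * Complex.I)) z

end TraceFormula

end

namespace TraceFormula

/-! ### Integration against complex measures -/

section ComplexMeasure

open scoped ENNReal

variable {α : Type*} [MeasurableSpace α]

/-! Put `λ = z ^ n` with `z` in the sector `0 ≤ arg z ≤ 2π/n`. The contour has speed `O(|z| ^ n)` in
the angle, so it suffices that the integral of the diagonal `G₀(x, x, z ^ n)` against `q` is `o(|z|
^ (-n))`, uniformly on the contours.

The homogeneous solutions are `exp (κ_k x)` with `κ_k = i z ρ ^ k`. For `k < ν` they do not grow on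
`[a, b]`, for `k ≥ ν` they do not decay, and since `n` is odd at most one `κ_k` has real part small
compared with `|z|` (`exists_hasDichotomy`). Normalizing each exponential at the end point where it
is largest, one obtains the diagonal as a constant in `x` plus a double sum of `g_jk c_k exp (κ_j (x
- near_j) + κ_k (far_k - x))`, where `|c_k| = |z| ^ (1 - n) / n` (`greenFunction_diagonal_eq`).

The condition `q([a, b]) = 0` kills the constant and all terms with `j = k`. If `j ≠ k`, one of the
two factors decays at rate `c |z|` away from an end point. Integration by parts turns the integral
into `-∫ κ exp(..) Q`, with `|κ| ≤ 2 |z|` and `Q(x) = o(x - a)` at `a`, `Q(x) = o(b - x)` at `b`;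
since `∫ t e^{-st} dt` is of order `s⁻²`, each term contributes `|z| ^ (1 - n) · |z| · o(|z| ^
(-2))` (`exists_mul_norm_complexIntegral_exp_le`).

What remains is that the matrix `g` is bounded. It is minus the inverse of the characteristic matrix
times a bounded matrix, so the characteristic determinant must be bounded below. Up to a small error
this determinant is `θ + e(z) θ'`, with `θ ≠ 0` by Birkhoff regularity and `e` the possibly neutral
exponential. It vanishes only at roots of eigenvalues, and the contours keep away from these; a
minimum modulus argument on a disc converts this into the lower bound
(`exists_le_norm_det_charMatrix`). Acceptability speaks only of roots in the sector, while the disc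
may leave it, hence `IsAcceptable.exists_separation`. -/

lemma variation_le_re_add_im (q : ComplexMeasure α) :
    q.variation ≤ (ComplexMeasure.re q).totalVariation + (ComplexMeasure.im q).totalVariation := by
  refine VectorMeasure.variation_le_of_forall_enorm_le fun s _ => ?_
  have e1 : ‖((q s).re : ℂ)‖ₑ = ‖ComplexMeasure.re q s‖ₑ := by
    rw [← ofReal_norm, ← ofReal_norm, Complex.norm_real]; rfl
  have e2 : ‖((q s).im : ℂ) * Complex.I‖ₑ = ‖ComplexMeasure.im q s‖ₑ := by
    rw [← ofReal_norm, ← ofReal_norm, norm_mul, Complex.norm_I, mul_one, Complex.norm_real]; rfl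
  calc ‖q s‖ₑ = ‖((q s).re : ℂ) + (q s).im * Complex.I‖ₑ := by rw [Complex.re_add_im]
    _ ≤ ‖((q s).re : ℂ)‖ₑ + ‖((q s).im : ℂ) * Complex.I‖ₑ := enorm_add_le _ _
    _ ≤ _ := by
      rw [e1, e2]
      exact add_le_add (SignedMeasure.enorm_le_totalVariation _ _)
        (SignedMeasure.enorm_le_totalVariation _ _)

instance isFiniteMeasure_variation (q : ComplexMeasure α) : IsFiniteMeasure q.variation :=
  isFiniteMeasure_of_le _ (variation_le_re_add_im q)

/-- The positive and negative parts of the real and imaginary parts of a complex measure. -/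
noncomputable def measurePart (q : ComplexMeasure α) : Fin 4 → Measure α :=
  ![(ComplexMeasure.re q).toJordanDecomposition.posPart,
    (ComplexMeasure.re q).toJordanDecomposition.negPart,
    (ComplexMeasure.im q).toJordanDecomposition.posPart,
    (ComplexMeasure.im q).toJordanDecomposition.negPart]

/-- The coefficients `1, -1, i, -i` of the parts of a complex measure. -/
def partCoeff : Fin 4 → ℂ := ![1, -1, Complex.I, -Complex.I]

instance (q : ComplexMeasure α) (i : Fin 4) : IsFiniteMeasure (measurePart q i) := by
  fin_cases i <;> simp [measurePart] <;> infer_instance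

lemma apply_eq_sum_parts (q : ComplexMeasure α) {s : Set α} (hs : MeasurableSet s) :
    q s = ∑ i, partCoeff i * ((measurePart q i).real s : ℂ) := by
  have h1 := SignedMeasure.apply_eq_posPart_real_sub_negPart_real (ComplexMeasure.re q) hs
  have h2 := SignedMeasure.apply_eq_posPart_real_sub_negPart_real (ComplexMeasure.im q) hs
  have e1 : ComplexMeasure.re q s = (q s).re := rfl
  have e2 : ComplexMeasure.im q s = (q s).im := rfl
  rw [← Complex.re_add_im (q s), ← e1, ← e2, h1, h2]
  simp only [Fin.sum_univ_four, partCoeff, measurePart, Matrix.cons_val]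
  push_cast
  ring

lemma variation_le_sum_parts (q : ComplexMeasure α) : q.variation ≤ ∑ i, measurePart q i := by
  refine (variation_le_re_add_im q).trans (le_of_eq ?_)
  simp only [Fin.sum_univ_four, measurePart, Matrix.cons_val, SignedMeasure.totalVariation, add_assoc]

lemma measurePart_le_sum (q : ComplexMeasure α) (i : Fin 4) :
    measurePart q i ≤ ∑ i, measurePart q i :=
  Finset.single_le_sum (f := measurePart q) (fun _ _ => Measure.zero_le _) (Finset.mem_univ i)

lemma complexIntegral_add (q : ComplexMeasure α) {f g : α → ℂ} (hf : Integrable f q.variation)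
    (hg : Integrable g q.variation) :
    complexIntegral q (f + g) = complexIntegral q f + complexIntegral q g :=
  VectorMeasure.integral_add hf hg

/-- Reduces integration against a complex measure to four finite positive measures, where Fubini is
available. Both sides are linear and L¹-continuous in `f` and agree on indicators. -/
theorem complexIntegral_eq_sum_parts (q : ComplexMeasure α) {f : α → ℂ}
    (hf : Integrable f (∑ i, measurePart q i)) :
    complexIntegral q f = ∑ i, partCoeff i * ∫ x, f x ∂(measurePart q i) := by
  have hle : ∀ i, measurePart q i ≤ (1 : ℝ≥0∞) • ∑ i, measurePart q i := fun i => by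
    simpa using measurePart_le_sum q i
  have hvle : q.variation ≤ (1 : ℝ≥0∞) • ∑ i, measurePart q i := by
    simpa using variation_le_sum_parts q
  have hint : ∀ {g : α → ℂ}, Integrable g (∑ i, measurePart q i) → ∀ i,
      Integrable g (measurePart q i) := fun hg i => hg.mono_measure (measurePart_le_sum q i)
  have hqint : ∀ {g : α → ℂ}, Integrable g (∑ i, measurePart q i) →
      Integrable g q.variation := fun hg => hg.mono_measure (variation_le_sum_parts q)
  refine Integrable.induction (μ := ∑ i, measurePart q i)
    (P := fun f => complexIntegral q f = ∑ i, partCoeff i * ∫ x, f x ∂(measurePart q i))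
    ?_ ?_ ?_ ?_ hf
  · intro c s hs _
    rw [complexIntegral, VectorMeasure.integral_eq_setToFun, setToFun_indicator_const _ hs
      (measure_ne_top _ _)]
    rw [transpose_eq_cbmApplyMeasure, cbmApplyMeasure_apply, ContinuousLinearMap.mul_apply']
    simp only [integral_indicator_const _ hs]
    rw [apply_eq_sum_parts q hs, Finset.mul_sum]
    refine Finset.sum_congr rfl fun i _ => ?_
    rw [Complex.real_smul]; ring
  · intro f g _ hf hg ihf ihg
    rw [complexIntegral_add q (hqint hf) (hqint hg), ihf, ihg, ← Finset.sum_add_distrib]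
    refine Finset.sum_congr rfl fun i _ => ?_
    rw [← mul_add]
    congr 1
    exact (integral_add (hint hf i) (hint hg i)).symm
  -- Continuity is needed on one common L¹ space, so each integral is rewritten as a `setToFun` over
  -- the sum of the parts, which dominates both the variation and every single part.
  · refine isClosed_eq ?_ (continuous_finsetSum _ fun i _ => continuous_const.mul ?_)
    · have hT := dominatedFinMeasAdditive_cbmApplyMeasure q (ContinuousLinearMap.mul ℝ ℂ)
      have hT' := hT.of_measure_le (variation_le_sum_parts q)
        (ContinuousLinearMap.opNorm_nonneg _)
      refine (continuous_setToFun hT').congr fun f => ?_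
      exact setToFun_congr_measure_of_integrable 1 ENNReal.one_ne_top hvle hT' hT f
        (L1.integrable_coeFn f)
    · have hT := dominatedFinMeasAdditive_weightedSMul (F := ℂ) (measurePart q i)
      have hT' := hT.of_measure_le (measurePart_le_sum q i) zero_le_one
      refine (continuous_setToFun hT').congr fun f => ?_
      rw [integral_eq_setToFun]
      exact setToFun_congr_measure_of_integrable 1 ENNReal.one_ne_top (hle i) hT' hT f
        (L1.integrable_coeFn f)
  · intro f g hfg hf h
    have e : complexIntegral q g = complexIntegral q f :=
      (VectorMeasure.integral_congr_ae
        ((variation_le_sum_parts q).absolutelyContinuous.ae_le hfg)).symm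
    rw [e, h]
    refine Finset.sum_congr rfl fun i _ => ?_
    rw [integral_congr_ae ((measurePart_le_sum q i).absolutelyContinuous.ae_le hfg)]

lemma complexIntegral_const (q : ComplexMeasure α) (hq : q univ = 0) (c : ℂ) :
    complexIntegral q (fun _ => c) = 0 := by
  rw [complexIntegral, VectorMeasure.integral_const, hq, _root_.map_zero]

lemma complexIntegral_const_mul (q : ComplexMeasure α) (c : ℂ) {f : α → ℂ}
    (hf : Integrable f (∑ i, measurePart q i)) :
    complexIntegral q (fun x => c * f x) = c * complexIntegral q f := by
  rw [complexIntegral_eq_sum_parts q hf, complexIntegral_eq_sum_parts q (hf.const_mul c),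
    Finset.mul_sum]
  refine Finset.sum_congr rfl fun i _ => ?_
  rw [integral_const_mul]
  ring

end ComplexMeasure

/-! ### Distribution functions and integration by parts -/

variable {a b : ℝ}

/-- Insert `f x = f b - ∫_x^b f'` and exchange the integrals: the point `t` is then weighted by the
mass of `{x ≤ t}`. -/
lemma integral_eq_sub_integral_deriv_mul (hab : a ≤ b) (μ : Measure (Icc a b)) [IsFiniteMeasure μ]
    {f f' : ℝ → ℂ} (hf : ∀ x, HasDerivAt f (f' x) x) (hf' : Continuous f') :
    ∫ x : Icc a b, f x ∂μ =
      f b * μ.real univ - ∫ t in a..b, f' t * (μ.real {x | (x : ℝ) ≤ t} : ℂ) := by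
  have hpt : ∀ x : Icc a b, f x = f b - ∫ t in a..b, (Ici (x : ℝ)).indicator f' t := by
    intro x
    have h1 : ∫ t in (x : ℝ)..b, f' t = f b - f x :=
      intervalIntegral.integral_eq_sub_of_hasDerivAt (fun t _ => hf t)
        (hf'.intervalIntegrable _ _)
    have h2 : ∫ t in a..b, (Ici (x : ℝ)).indicator f' t = ∫ t in (x : ℝ)..b, f' t := by
      rw [intervalIntegral.integral_of_le hab, intervalIntegral.integral_of_le x.2.2,
        setIntegral_indicator measurableSet_Ici]
      refine setIntegral_congr_set ?_
      -- The integration range is half-open at `a`. For `x = a` the intersection is `Ioc a b`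
      -- itself; for `x > a` it is `Icc x b`, which differs from `Ioc x b` by a null set.
      rcases eq_or_lt_of_le x.2.1 with h | h
      · rw [← h]
        refine Filter.EventuallyEq.of_eq ?_
        ext t
        exact ⟨fun ht => ht.1, fun ht => ⟨ht, ht.1.le⟩⟩
      · have e : Ioc a b ∩ Ici (x : ℝ) = Icc (x : ℝ) b := by
          ext t
          exact ⟨fun ht => ⟨ht.2, ht.1.2⟩, fun ht => ⟨⟨h.trans_le ht.1, ht.2⟩, ht.1⟩⟩
        rw [e]
        exact Ioc_ae_eq_Icc.symm
    rw [h2, h1]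
    ring
  obtain ⟨C, hC⟩ := isCompact_Icc.exists_bound_of_continuousOn (hf'.continuousOn (s := Icc a b))
  have hmeas : MeasurableSet {p : ℝ × Icc a b | (p.2 : ℝ) ≤ p.1} :=
    measurableSet_le (by fun_prop) (by fun_prop)
  have hint : Integrable (Function.uncurry fun (t : ℝ) (x : Icc a b) =>
      (Ici (x : ℝ)).indicator f' t) ((volume.restrict (uIoc a b)).prod μ) := by
    have hmeas' : Measurable (Function.uncurry fun (t : ℝ) (x : Icc a b) =>
        (Ici (x : ℝ)).indicator f' t) := by
      have e : (Function.uncurry fun (t : ℝ) (x : Icc a b) => (Ici (x : ℝ)).indicator f' t) =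
          {p : ℝ × Icc a b | (p.2 : ℝ) ≤ p.1}.indicator (fun p => f' p.1) := by
        ext ⟨t, x⟩
        simp [indicator]
      rw [e]
      exact (hf'.measurable.comp measurable_fst).indicator hmeas
    have : IsFiniteMeasure (volume.restrict (uIoc a b)) := by
      rw [uIoc_of_le hab]; infer_instance
    refine Integrable.of_bound hmeas'.aestronglyMeasurable C ?_
    have hae : ∀ᵐ p : ℝ × Icc a b ∂((volume.restrict (uIoc a b)).prod μ), p.1 ∈ uIoc a b :=
      Measure.quasiMeasurePreserving_fst.ae (ae_restrict_mem measurableSet_uIoc)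
    filter_upwards [hae] with p hp
    rw [uIoc_of_le hab] at hp
    exact (norm_indicator_le_norm_self _ _).trans (hC p.1 ⟨hp.1.le, hp.2⟩)
  have hswap := intervalIntegral_integral_swap hint
  have hint2 : Integrable (fun x : Icc a b => ∫ t in a..b, (Ici (x : ℝ)).indicator f' t) μ := by
    have := hint.integral_prod_right
    simpa only [intervalIntegral.integral_of_le hab, uIoc_of_le hab, Function.uncurry_apply_pair]
      using this
  calc ∫ x : Icc a b, f x ∂μ
      = ∫ x : Icc a b, (f b - ∫ t in a..b, (Ici (x : ℝ)).indicator f' t) ∂μ := by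
        refine integral_congr_ae (Filter.Eventually.of_forall fun x => hpt x)
    _ = f b * μ.real univ - ∫ t in a..b, ∫ x : Icc a b, (Ici (x : ℝ)).indicator f' t ∂μ := by
        rw [integral_sub (integrable_const _) hint2, hswap, integral_const, Complex.real_smul,
          mul_comm]
    _ = _ := by
        congr 1
        refine intervalIntegral.integral_congr fun t _ => ?_
        have e : (fun x : Icc a b => (Ici (x : ℝ)).indicator f' t) =
            {x : Icc a b | (x : ℝ) ≤ t}.indicator fun _ => f' t := by
          ext x
          simp [indicator]
        rw [e, integral_indicator_const _ (measurableSet_le (by fun_prop) (by fun_prop)),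
          Complex.real_smul, mul_comm]

lemma distributionFunction_eq_sum (q : ComplexMeasure (Icc a b)) (t : ℝ) :
    distributionFunction q t =
      ∑ i, partCoeff i * ((measurePart q i).real {x | (x : ℝ) ≤ t} : ℂ) :=
  apply_eq_sum_parts q (measurableSet_le (by fun_prop) (by fun_prop))

lemma monotone_measureReal_le (μ : Measure (Icc a b)) [IsFiniteMeasure μ] :
    Monotone fun t : ℝ => μ.real {x | (x : ℝ) ≤ t} := fun _ _ hst =>
  measureReal_mono fun _ hx => le_trans hx hst

lemma measurable_distributionFunction (q : ComplexMeasure (Icc a b)) :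
    Measurable (distributionFunction q) := by
  have e : distributionFunction q = fun t =>
      ∑ i, partCoeff i * ((measurePart q i).real {x | (x : ℝ) ≤ t} : ℂ) :=
    funext (distributionFunction_eq_sum q)
  rw [e]
  refine Finset.measurable_fun_sum _ fun i _ => measurable_const.mul ?_
  exact Complex.measurable_ofReal.comp (monotone_measureReal_le _).measurable

lemma exists_norm_distributionFunction_le (q : ComplexMeasure (Icc a b)) :
    ∃ C > 0, ∀ t, ‖distributionFunction q t‖ ≤ C :=
  ⟨q.bound + 1, by positivity, fun _ =>
    (VectorMeasure.norm_apply_le_bound (μ := q)).trans (by linarith)⟩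

/-- Integration by parts against a complex measure of total mass zero. -/
theorem complexIntegral_eq_neg_integral_deriv_mul (hab : a ≤ b) (q : ComplexMeasure (Icc a b))
    (hq : q univ = 0) {f f' : ℝ → ℂ} (hf : ∀ x, HasDerivAt f (f' x) x) (hf' : Continuous f') :
    complexIntegral q (fun x => f x) = -∫ t in a..b, f' t * distributionFunction q t := by
  have hcont : Continuous f := continuous_iff_continuousAt.2 fun x => (hf x).continuousAt
  have hint : Integrable (fun x : Icc a b => f x) (∑ i, measurePart q i) :=
    (hcont.comp continuous_subtype_val).integrable_of_hasCompactSupport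
      (HasCompactSupport.of_compactSpace _)
  have hii : ∀ i, IntervalIntegrable
      (fun t => f' t * ((measurePart q i).real {x | (x : ℝ) ≤ t} : ℂ)) volume a b := by
    intro i
    have h1 : IntervalIntegrable (fun t => ((measurePart q i).real {x | (x : ℝ) ≤ t} : ℂ))
        volume a b :=
      let h := (monotone_measureReal_le (measurePart q i)).intervalIntegrable (a := a) (b := b)
      ⟨h.1.ofReal, h.2.ofReal⟩
    exact h1.continuousOn_mul hf'.continuousOn
  rw [complexIntegral_eq_sum_parts q hint]
  simp only [integral_eq_sub_integral_deriv_mul hab _ hf hf', mul_sub, Finset.sum_sub_distrib]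
  have h0 : ∑ i, partCoeff i * (f b * ((measurePart q i).real univ : ℂ)) = 0 := by
    have := apply_eq_sum_parts q MeasurableSet.univ
    rw [hq] at this
    calc _ = f b * ∑ i, partCoeff i * ((measurePart q i).real univ : ℂ) := by
          rw [Finset.mul_sum]; exact Finset.sum_congr rfl fun i _ => by ring
      _ = 0 := by rw [← this, mul_zero]
  rw [h0, zero_sub]
  congr 1
  simp only [← intervalIntegral.integral_const_mul]
  rw [← intervalIntegral.integral_finsetSum fun i _ => (hii i).const_mul _]
  refine intervalIntegral.integral_congr fun t _ => ?_
  simp only [distributionFunction_eq_sum, Finset.mul_sum]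
  exact Finset.sum_congr rfl fun i _ => by ring

end TraceFormula

namespace TraceFormula

/-! ### Exponential moments concentrated at an end point -/

section Edge

variable {a b : ℝ}

lemma integral_exp_neg_le {σ : ℝ} (hσ : 0 < σ) :
    ∫ x in a..b, Real.exp (-σ * (x - a)) ≤ 1 / σ := by
  have hd : ∀ x ∈ uIcc a b, HasDerivAt (fun x => -Real.exp (-σ * (x - a)) / σ)
      (Real.exp (-σ * (x - a))) x := by
    intro x _
    have h := ((((hasDerivAt_id x).sub_const a).const_mul (-σ)).exp.neg).div_const σ
    have e : -(Real.exp (-σ * (id x - a)) * (-σ * 1)) / σ = Real.exp (-σ * (x - a)) := by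
      rw [id]; field_simp
    rwa [e] at h
  rw [intervalIntegral.integral_eq_sub_of_hasDerivAt hd
    (Continuous.intervalIntegrable (by fun_prop) _ _)]
  have := Real.exp_pos (-σ * (b - a))
  simp only [sub_self, mul_zero, Real.exp_zero]
  rw [← sub_div]
  gcongr
  linarith

/-- Half of the decay rate absorbs the factor `t`, because `u ≤ exp u`. -/
lemma mul_exp_neg_le {s t : ℝ} (hs : 0 < s) :
    t * Real.exp (-s * t) ≤ 2 / s * Real.exp (-(s / 2) * t) := by
  have h1 : s * t / 2 ≤ Real.exp (s / 2 * t) := by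
    have := Real.add_one_le_exp (s / 2 * t); linarith
  have h2 : Real.exp (-s * t) = Real.exp (-(s / 2) * t) * Real.exp (-(s / 2) * t) := by
    rw [← Real.exp_add]; ring_nf
  have h3 : Real.exp (s / 2 * t) * Real.exp (-(s / 2) * t) = 1 := by
    rw [← Real.exp_add]; simp
  have h4 := Real.exp_pos (-(s / 2) * t)
  have h5 : s * t / 2 * Real.exp (-(s / 2) * t) ≤ 1 := by
    rw [← h3]; gcongr
  rw [h2, ← mul_assoc]
  gcongr
  rw [le_div_iff₀ hs]
  linarith

lemma sq_mul_exp_neg_le {s t : ℝ} (hs : 0 < s) (ht : 0 ≤ t) :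
    t ^ 2 * Real.exp (-s * t) ≤ 16 / s ^ 2 * Real.exp (-(s / 2) * t) := by
  have h1 : s * t / 4 ≤ Real.exp (s / 4 * t) := by
    have := Real.add_one_le_exp (s / 4 * t); linarith
  have h2 : Real.exp (-s * t) =
      Real.exp (-(s / 4) * t) * Real.exp (-(s / 4) * t) * Real.exp (-(s / 2) * t) := by
    rw [← Real.exp_add, ← Real.exp_add]; ring_nf
  have h3 : Real.exp (s / 4 * t) * Real.exp (-(s / 4) * t) = 1 := by
    rw [← Real.exp_add]; simp
  have h4 := Real.exp_pos (-(s / 4) * t)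
  have h5 : s * t / 4 * Real.exp (-(s / 4) * t) ≤ 1 := by
    rw [← h3]; gcongr
  have h6 : (s * t / 4 * Real.exp (-(s / 4) * t)) ^ 2 ≤ 1 :=
    pow_le_one₀ (by positivity) h5
  rw [h2, ← mul_assoc]
  gcongr
  rw [le_div_iff₀ (by positivity)]
  nlinarith

/-- Within some `η` of `a` the vanishing derivative gives the linear term; farther away the
quadratic term with constant of order `η⁻²` exceeds the uniform bound. This makes the local
condition `F = o(x - a)` a global one that can be integrated. -/
lemma exists_norm_le_linear_add_sq {F : ℝ → ℂ} {C : ℝ} (hC : ∀ x, ‖F x‖ ≤ C)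
    (hF : F a = 0) (hF' : HasDerivWithinAt F 0 (Icc a b) a) {ε : ℝ} (hε : 0 < ε) :
    ∃ C' > 0, ∀ x ∈ Icc a b, ‖F x‖ ≤ ε * (x - a) + C' * (x - a) ^ 2 := by
  have h := hF'.isLittleO
  simp only [hF, smul_zero, sub_zero] at h
  have h2 := h.bound hε
  rw [eventually_nhdsWithin_iff, Metric.eventually_nhds_iff] at h2
  obtain ⟨η, hη, h3⟩ := h2
  have hC0 : 0 ≤ C := (norm_nonneg _).trans (hC a)
  refine ⟨(C + 1) / η ^ 2, by positivity, fun x hx => ?_⟩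
  have hxa : 0 ≤ x - a := sub_nonneg.2 hx.1
  rcases lt_or_ge (x - a) η with h4 | h4
  · have := h3 (y := x) (by rwa [Real.dist_eq, abs_of_nonneg hxa]) hx
    rw [Real.norm_eq_abs, abs_of_nonneg hxa] at this
    have : 0 ≤ (C + 1) / η ^ 2 * (x - a) ^ 2 := by positivity
    linarith
  · have h5 : C + 1 ≤ (C + 1) / η ^ 2 * (x - a) ^ 2 := by
      rw [div_mul_eq_mul_div, le_div_iff₀ (by positivity)]
      gcongr
    have := hC x
    have : 0 ≤ ε * (x - a) := by positivity
    linarith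

/-- Against `exp (-s (x - a))` the linear part of the bound for `F` integrates to `O(ε / s²)` and
the quadratic part to `O(s⁻³)`. -/
lemma exists_sq_mul_integral_exp_left_le (hab : a ≤ b) {F : ℝ → ℂ} (hFm : Measurable F) {C : ℝ}
    (hC : ∀ x, ‖F x‖ ≤ C) (hF : F a = 0) (hF' : HasDerivWithinAt F 0 (Icc a b) a)
    {ε : ℝ} (hε : 0 < ε) :
    ∃ S > 0, ∀ s ≥ S, s ^ 2 * ∫ x in a..b, Real.exp (-s * (x - a)) * ‖F x‖ ≤ ε := by
  -- With `ε / 8` the linear part contributes `ε/8 · 2/s · 2/s · s² = ε/2`; the quadratic part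
  -- contributes `32 C' / s`, at most `ε/2` once `s ≥ 64 C' / ε`.
  obtain ⟨C', hC', hb⟩ := exists_norm_le_linear_add_sq hC hF hF' (ε := ε / 8) (by positivity)
  refine ⟨64 * C' / ε, by positivity, fun s hs => ?_⟩
  have hs0 : 0 < s := lt_of_lt_of_le (by positivity) hs
  have hle : ∀ x ∈ Icc a b, Real.exp (-s * (x - a)) * ‖F x‖ ≤
      (ε / 8 * (2 / s) + C' * (16 / s ^ 2)) * Real.exp (-(s / 2) * (x - a)) := by
    intro x hx
    have h1 := mul_exp_neg_le (t := x - a) hs0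
    have h2 := sq_mul_exp_neg_le (t := x - a) hs0 (sub_nonneg.2 hx.1)
    calc Real.exp (-s * (x - a)) * ‖F x‖
        ≤ Real.exp (-s * (x - a)) * (ε / 8 * (x - a) + C' * (x - a) ^ 2) := by
          gcongr; exact hb x hx
      _ = ε / 8 * ((x - a) * Real.exp (-s * (x - a))) +
          C' * ((x - a) ^ 2 * Real.exp (-s * (x - a))) := by ring
      _ ≤ ε / 8 * (2 / s * Real.exp (-(s / 2) * (x - a))) +
          C' * (16 / s ^ 2 * Real.exp (-(s / 2) * (x - a))) := by gcongr
      _ = _ := by ring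
  have hint : IntervalIntegrable (fun x => Real.exp (-s * (x - a)) * ‖F x‖) volume a b := by
    have h1 : IntervalIntegrable (fun x => ‖F x‖) volume a b := by
      rw [intervalIntegrable_iff]
      exact Measure.integrableOn_of_bounded (M := C) (by simp) hFm.norm.aestronglyMeasurable
        (Eventually.of_forall fun x => by simpa using hC x)
    exact h1.continuousOn_mul (by fun_prop)
  have h3 := intervalIntegral.integral_mono_on hab hint
    (Continuous.intervalIntegrable (by fun_prop) _ _) hle
  rw [intervalIntegral.integral_const_mul] at h3
  have h4 := integral_exp_neg_le (a := a) (b := b) (σ := s / 2) (by positivity)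
  calc s ^ 2 * ∫ x in a..b, Real.exp (-s * (x - a)) * ‖F x‖
      ≤ s ^ 2 * ((ε / 8 * (2 / s) + C' * (16 / s ^ 2)) * (1 / (s / 2))) := by
        refine mul_le_mul_of_nonneg_left (h3.trans ?_) (by positivity)
        gcongr
    _ = ε / 2 + 32 * C' / s := by field_simp; ring
    _ ≤ ε / 2 + ε / 2 := by
        refine add_le_add le_rfl ?_
        rw [div_le_iff₀ hs0]
        rw [ge_iff_le, div_le_iff₀ hε] at hs
        linarith
    _ = ε := by ring

lemma exists_sq_mul_integral_exp_right_le (hab : a ≤ b) {F : ℝ → ℂ} (hFm : Measurable F) {C : ℝ}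
    (hC : ∀ x, ‖F x‖ ≤ C) (hF : F b = 0) (hF' : HasDerivWithinAt F 0 (Icc a b) b)
    {ε : ℝ} (hε : 0 < ε) :
    ∃ S > 0, ∀ s ≥ S, s ^ 2 * ∫ x in a..b, Real.exp (-s * (b - x)) * ‖F x‖ ≤ ε := by
  -- The reflection `x ↦ a + b - x` reduces the right end point to the left one.
  have hd : HasDerivWithinAt (fun x => F (a + b - x)) 0 (Icc a b) a := by
    have h1 : HasDerivWithinAt (fun x : ℝ => a + b - x) (-1) (Icc a b) a :=
      (hasDerivWithinAt_id a _).const_sub (a + b)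
    have h2 : HasDerivWithinAt F 0 (Icc a b) (a + b - a) := by simpa using hF'
    have h3 := HasDerivWithinAt.scomp (t' := Icc a b) a h2 h1 fun x hx => by
      simp only [mem_Icc] at *; constructor <;> linarith
    simpa [Function.comp_def] using h3
  obtain ⟨S, hS, h⟩ := exists_sq_mul_integral_exp_left_le hab
    (F := fun x => F (a + b - x)) (hFm.comp (by fun_prop)) (fun x => hC _) (by simpa using hF) hd hε
  refine ⟨S, hS, fun s hs => ?_⟩
  have h1 := h s hs
  have h2 := intervalIntegral.integral_comp_sub_left (a := a) (b := b)
    (fun x => Real.exp (-s * (b - x)) * ‖F x‖) (a + b)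
  have h3 : ∀ x : ℝ, b - (a + b - x) = x - a := fun x => by ring
  simp only [h3, add_sub_cancel_right, add_sub_cancel_left] at h2
  rwa [h2] at h1

end Edge

/-- Exponentials that decay away from one of the end points have moments `o(1 / r)`. -/
theorem exists_mul_norm_complexIntegral_exp_le {a b : ℝ} (hab : a ≤ b)
    (q : ComplexMeasure (Icc a b)) (hq : q univ = 0) (hqa : q {t | (t : ℝ) = a} = 0)
    (hQa : HasDerivWithinAt (distributionFunction q) 0 (Icc a b) a)
    (hQb : HasDerivWithinAt (distributionFunction q) 0 (Icc a b) b)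
    {c : ℝ} (hc : 0 < c) {ε : ℝ} (hε : 0 < ε) :
    ∃ R₀ > 0, ∀ r ≥ R₀, ∀ κ γ : ℂ, ‖κ‖ ≤ 2 * r →
      ((∀ x ∈ Icc a b, ‖Complex.exp (κ * x + γ)‖ ≤ Real.exp (-(c * r) * (x - a))) ∨
        ∀ x ∈ Icc a b, ‖Complex.exp (κ * x + γ)‖ ≤ Real.exp (-(c * r) * (b - x))) →
      r * ‖complexIntegral q fun x => Complex.exp (κ * x + γ)‖ ≤ ε := by
  obtain ⟨C, -, hC⟩ := exists_norm_distributionFunction_le q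
  have hFm := measurable_distributionFunction q
  have h0a : distributionFunction q a = 0 := by
    rw [← hqa, distributionFunction]
    congr 1
    ext t
    exact ⟨fun h => le_antisymm h t.2.1, fun h => le_of_eq h⟩
  have h0b : distributionFunction q b = 0 := by
    rw [← hq, distributionFunction]
    congr 1
    ext t
    simpa using t.2.2
  -- One factor `r` comes from the claim and a factor `2 r` from `κ`; since `2 r² = (2 / c²) (c
  -- r)²`, the moment at rate `s = c r` has to be at most `ε c² / 2`.
  have hε' : 0 < ε * c ^ 2 / 2 := by positivity
  obtain ⟨S₁, hS₁, h₁⟩ := exists_sq_mul_integral_exp_left_le hab hFm hC h0a hQa hε'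
  obtain ⟨S₂, hS₂, h₂⟩ := exists_sq_mul_integral_exp_right_le hab hFm hC h0b hQb hε'
  refine ⟨(S₁ + S₂) / c, by positivity, fun r hr κ γ hκ hdec => ?_⟩
  have hrc : S₁ + S₂ ≤ c * r := by
    rw [ge_iff_le, div_le_iff₀ hc] at hr; linarith
  have hr0 : 0 < r := lt_of_lt_of_le (by positivity) hr
  have hderiv : ∀ x : ℝ, HasDerivAt (fun x : ℝ => Complex.exp (κ * x + γ))
      (κ * Complex.exp (κ * x + γ)) x := by
    intro x
    have h := ((((hasDerivAt_id (x : ℂ)).const_mul κ).add_const γ).cexp).comp_ofReal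
    simpa [mul_comm] using h
  rw [complexIntegral_eq_neg_integral_deriv_mul hab q hq hderiv (by fun_prop), norm_neg]
  have hgint : IntervalIntegrable (fun x => ‖distributionFunction q x‖) volume a b := by
    rw [intervalIntegrable_iff]
    exact Measure.integrableOn_of_bounded (M := C) (by simp) hFm.norm.aestronglyMeasurable
      (Eventually.of_forall fun x => by simpa using hC x)
  have key : ∀ w : ℝ → ℝ, Continuous w →
      (∀ x ∈ Icc a b, ‖Complex.exp (κ * x + γ)‖ ≤ w x) →
      (c * r) ^ 2 * ∫ x in a..b, w x * ‖distributionFunction q x‖ ≤ ε * c ^ 2 / 2 →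
      r * ‖∫ t in a..b, κ * Complex.exp (κ * t + γ) * distributionFunction q t‖ ≤ ε := by
    intro w hw hle hfin
    have h1 : ‖∫ t in a..b, κ * Complex.exp (κ * t + γ) * distributionFunction q t‖ ≤
        ∫ x in a..b, 2 * r * (w x * ‖distributionFunction q x‖) := by
      refine intervalIntegral.norm_integral_le_of_norm_le hab ?_
        ((hgint.continuousOn_mul hw.continuousOn).const_mul _)
      refine Eventually.of_forall fun x hx => ?_
      rw [norm_mul, norm_mul, ← mul_assoc]
      gcongr
      exact hle x ⟨hx.1.le, hx.2⟩
    rw [intervalIntegral.integral_const_mul] at h1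
    have h2 : r * ‖∫ t in a..b, κ * Complex.exp (κ * t + γ) * distributionFunction q t‖ ≤
        r * (2 * r * ∫ x in a..b, w x * ‖distributionFunction q x‖) := by gcongr
    have h3 : c ^ 2 * (r * (2 * r * ∫ x in a..b, w x * ‖distributionFunction q x‖)) ≤
        c ^ 2 * ε := by linarith
    exact h2.trans (le_of_mul_le_mul_left h3 (by positivity))
  rcases hdec with h | h
  · exact key _ (by fun_prop) h (h₁ _ (by linarith))
  · exact key _ (by fun_prop) h (h₂ _ (by linarith))

end TraceFormula

namespace TraceFormula

/-! ### The exponents `i z ρ ^ k` -/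

/-- The primitive root of unity `exp (2πi/n)`. -/
noncomputable def unityRoot (n : ℕ) : ℂ := Complex.exp (2 * Real.pi * Complex.I / n)

lemma unityRoot_isPrimitiveRoot {n : ℕ} (hn : n ≠ 0) : IsPrimitiveRoot (unityRoot n) n :=
  Complex.isPrimitiveRoot_exp n hn

lemma norm_unityRoot (n : ℕ) : ‖unityRoot n‖ = 1 := by
  have : (2 * Real.pi * Complex.I / n : ℂ) = ((2 * Real.pi / n : ℝ) : ℂ) * Complex.I := by
    push_cast; ring
  rw [unityRoot, this, Complex.norm_exp_ofReal_mul_I]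

/-- The exponents `i z ρ ^ k` of the solutions of `(-i)^n y^(n) = z^n y`. -/
noncomputable def exponent (n : ℕ) (z : ℂ) (k : Fin n) : ℂ := Complex.I * z * unityRoot n ^ (k : ℕ)

variable {n : ℕ} {z : ℂ}

lemma norm_exponent (k : Fin n) : ‖exponent n z k‖ = ‖z‖ := by
  simp [exponent, norm_unityRoot]

lemma exponent_pow (k : Fin n) : exponent n z k ^ n = (Complex.I * z) ^ n := by
  have hn : n ≠ 0 := fun h => by subst h; exact k.elim0
  rw [exponent, mul_pow, ← pow_mul, mul_comm (k : ℕ), pow_mul,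
    (unityRoot_isPrimitiveRoot hn).pow_eq_one, one_pow, mul_one]

lemma exponent_injective (hz : z ≠ 0) : Function.Injective (exponent n z) := by
  intro i j hij
  have hn : n ≠ 0 := fun h => by subst h; exact i.elim0
  have h := mul_left_cancel₀ (mul_ne_zero Complex.I_ne_zero hz) hij
  exact Fin.ext ((unityRoot_isPrimitiveRoot hn).pow_inj i.2 j.2 h)

lemma sum_exponent_pow_eq_zero (hn : n ≠ 0) {m : ℕ} (hm : ¬ n ∣ m) :
    ∑ k, exponent n z k ^ m = 0 := by
  have hρ := unityRoot_isPrimitiveRoot hn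
  have h1 : ∑ k ∈ Finset.range n, (unityRoot n ^ m) ^ k = 0 := by
    have hne : unityRoot n ^ m ≠ 1 := fun h => hm (hρ.dvd_of_pow_eq_one m h)
    have h2 := geom_sum_mul (unityRoot n ^ m) n
    rw [← pow_mul, mul_comm m, pow_mul, hρ.pow_eq_one, one_pow, sub_self] at h2
    exact (mul_eq_zero.1 h2).resolve_right (sub_ne_zero.2 hne)
  rw [Finset.sum_range] at h1
  calc ∑ k, exponent n z k ^ m
      = (Complex.I * z) ^ m * ∑ k : Fin n, (unityRoot n ^ m) ^ (k : ℕ) := by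
        rw [Finset.mul_sum]
        refine Finset.sum_congr rfl fun k _ => ?_
        rw [exponent, mul_pow, ← pow_mul, ← pow_mul, mul_comm (k : ℕ)]
    _ = 0 := by rw [h1, mul_zero]

lemma sum_exponent_pow_self : ∑ k, exponent n z k ^ n = n * (Complex.I * z) ^ n := by
  simp [exponent_pow]

/-- Orthogonality of characters: the total exponent `n + m - l` lies strictly between `0` and `2 n`,
so it is divisible by `n` only if `m = l`. -/
lemma sum_exponent_pow_mul_pow {m l : ℕ} (hm : m < n) (hl : l < n) :
    ∑ k, exponent n z k ^ (m + 1) * exponent n z k ^ (n - 1 - l) =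
      if m = l then n * (Complex.I * z) ^ n else 0 := by
  simp only [← pow_add]
  split_ifs with h
  · subst h
    rw [show m + 1 + (n - 1 - m) = n by omega, sum_exponent_pow_self]
  · refine sum_exponent_pow_eq_zero (by omega) fun hd => ?_
    obtain ⟨t, ht⟩ := hd
    have h1 : 0 < t := by
      rcases Nat.eq_zero_or_pos t with h0 | h0
      · subst h0; omega
      · exact h0
    have h2 : t < 2 := by
      by_contra h2
      have : n * 2 ≤ n * t := Nat.mul_le_mul_left n (by omega)
      omega
    have : t = 1 := by omega
    subst this
    omega

lemma eq_zero_of_sum_mul_exponent_pow (hz : z ≠ 0) {v : Fin n → ℂ}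
    (h : ∀ m < n, ∑ k, v k * exponent n z k ^ m = 0) : v = 0 :=
  Matrix.eq_zero_of_forall_pow_sum_mul_pow_eq_zero (exponent_injective hz) fun i => h i i.2

/-! ### Iterated derivatives given by a chain of functions -/

section Chain

variable {a b : ℝ}

/-- The open set `s` serves to remove the diagonal point: derivatives are taken within all of `[a,
b]`, while the chain is only known off that point. Openness lets the identity of order `m` be
differentiated. -/
lemma iteratedDerivWithin_eq_of_chain (hab : a < b) {Y : ℕ → ℝ → ℂ} {s : Set ℝ} (hs : IsOpen s)
    {N : ℕ} (h : ∀ m < N, ∀ x ∈ Icc a b ∩ s, HasDerivWithinAt (Y m) (Y (m + 1) x) (Icc a b) x) :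
    ∀ m ≤ N, ∀ x ∈ Icc a b ∩ s, iteratedDerivWithin m (Y 0) (Icc a b) x = Y m x := by
  intro m
  induction m with
  | zero => intro _ x _; rw [iteratedDerivWithin_zero]
  | succ m ih =>
    intro hm x hx
    rw [iteratedDerivWithin_succ]
    have heq : iteratedDerivWithin m (Y 0) (Icc a b) =ᶠ[𝓝[Icc a b] x] Y m := by
      filter_upwards [self_mem_nhdsWithin, mem_nhdsWithin_of_mem_nhds (hs.mem_nhds hx.2)]
        with t ht1 ht2
      exact ih (by omega) t ⟨ht1, ht2⟩
    rw [heq.derivWithin_eq (ih (by omega) x hx)]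
    exact (h m (by omega) x hx).derivWithin (uniqueDiffOn_Icc hab x hx.1)

lemma contDiffOn_of_chain {s : Set ℝ} (hs : UniqueDiffOn ℝ s) {N : ℕ} {Y : ℕ → ℝ → ℂ}
    (h : ∀ m < N, ∀ x ∈ s, HasDerivWithinAt (Y m) (Y (m + 1) x) s x)
    (hc : ContinuousOn (Y N) s) : ContDiffOn ℝ N (Y 0) s := by
  induction N generalizing Y with
  | zero => simpa using hc
  | succ N ih =>
    have h1 : ContDiffOn ℝ N (Y 1) s :=
      ih (Y := fun m => Y (m + 1)) (fun m hm x hx => h (m + 1) (by omega) x hx) hc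
    have h2 := (contDiffOn_succ_iff_derivWithin (n := N) (f := Y 0) hs).2
      ⟨fun x hx => (h 0 (by omega) x hx).differentiableWithinAt, by simp,
        h1.congr fun x hx => (h 0 (by omega) x hx).derivWithin (hs x hx)⟩
    exact_mod_cast h2

end Chain

/-! ### Boundary forms -/

section Boundary

variable {a b : ℝ}

lemma boundaryForm_eq_sum {P Q : ℂ[X]} (hP : P.natDegree < n) (hQ : Q.natDegree < n)
    (y : ℝ → ℂ) : boundaryForm a b P Q y =
      ∑ m ∈ Finset.range n, (P.coeff m * iteratedDerivWithin m y (Icc a b) a +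
        Q.coeff m * iteratedDerivWithin m y (Icc a b) b) := by
  rw [boundaryForm, Finset.sum_add_distrib, Polynomial.sum_over_range' P _ n hP,
    Polynomial.sum_over_range' Q _ n hQ] <;> simp

lemma sum_coeff_mul_eq_sum_mul_eval {P Q : ℂ[X]} (hP : P.natDegree < n) (hQ : Q.natDegree < n)
    (κ α β : Fin n → ℂ) :
    ∑ m ∈ Finset.range n, (P.coeff m * ∑ j, α j * κ j ^ m + Q.coeff m * ∑ j, β j * κ j ^ m) =
      ∑ j, (α j * P.eval (κ j) + β j * Q.eval (κ j)) := by
  simp only [Polynomial.eval_eq_sum_range' hP, Polynomial.eval_eq_sum_range' hQ, Finset.mul_sum,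
    ← Finset.sum_add_distrib]
  rw [Finset.sum_comm]
  refine Finset.sum_congr rfl fun j _ => Finset.sum_congr rfl fun m _ => ?_
  ring

/-- The boundary form of an exponential `exp (κ x)`. -/
noncomputable def expForm (a b : ℝ) (P Q : ℂ[X]) (κ : ℂ) : ℂ :=
  P.eval κ * Complex.exp (κ * a) + Q.eval κ * Complex.exp (κ * b)

end Boundary

/-! ### Existence of the Green function -/

section Green

variable {a b : ℝ} {P Q : Fin n → ℂ[X]}

/-- The coefficients of the fundamental solution. -/
noncomputable def fundCoeff (n : ℕ) (z : ℂ) (k : Fin n) : ℂ :=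
  ((-Complex.I) ^ n)⁻¹ * exponent n z k / (n * (Complex.I * z) ^ n)

/-- The solution of `(-i)^n y^(n) = z^n y` with zero data at `0` up to order `n - 2`, and its
derivatives. -/
noncomputable def fundSol (n : ℕ) (z : ℂ) (m : ℕ) (t : ℝ) : ℂ :=
  ∑ k, fundCoeff n z k * exponent n z k ^ m * Complex.exp (exponent n z k * t)

/-- The restriction of `fundSol` to the half-line `t ≥ 0`, continued by zero. -/
noncomputable def causalSol (n : ℕ) (z : ℂ) (m : ℕ) (t : ℝ) : ℂ :=
  if 0 ≤ t then fundSol n z m t else 0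

/-- The Green function built from `causalSol` and homogeneous solutions with coefficients `D`, and
its derivatives in the first variable. -/
noncomputable def greenCandidate (n : ℕ) (z : ℂ) (D : Fin n → ℝ → ℂ) (m : ℕ) (x ξ : ℝ) : ℂ :=
  causalSol n z m (x - ξ) +
    ∑ j, D j ξ * exponent n z j ^ m * Complex.exp (exponent n z j * x)

lemma hasDerivAt_cexp_mul (κ : ℂ) (x : ℝ) :
    HasDerivAt (fun x : ℝ => Complex.exp (κ * x)) (κ * Complex.exp (κ * x)) x := by
  have h := (((hasDerivAt_id (x : ℂ)).const_mul κ).cexp).comp_ofReal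
  simpa [mul_comm] using h

lemma hasDerivAt_sum_cexp (v κ : Fin n → ℂ) (m : ℕ) (x : ℝ) :
    HasDerivAt (fun x : ℝ => ∑ j, v j * κ j ^ m * Complex.exp (κ j * x))
      (∑ j, v j * κ j ^ (m + 1) * Complex.exp (κ j * x)) x := by
  refine HasDerivAt.fun_sum fun j _ => ?_
  have h := (hasDerivAt_cexp_mul (κ j) x).const_mul (v j * κ j ^ m)
  rwa [show v j * κ j ^ m * (κ j * Complex.exp (κ j * x)) =
    v j * κ j ^ (m + 1) * Complex.exp (κ j * x) by ring] at h

lemma hasDerivAt_fundSol (m : ℕ) (t : ℝ) :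
    HasDerivAt (fundSol n z m) (fundSol n z (m + 1) t) t :=
  hasDerivAt_sum_cexp _ _ m t

lemma continuous_fundSol (m : ℕ) : Continuous (fundSol n z m) :=
  continuous_iff_continuousAt.2 fun t => (hasDerivAt_fundSol m t).continuousAt

lemma fundSol_zero_eq (m : ℕ) : fundSol n z m 0 =
    ((-Complex.I) ^ n)⁻¹ * (∑ k, exponent n z k ^ (m + 1)) / (n * (Complex.I * z) ^ n) := by
  simp only [fundSol, fundCoeff, Complex.ofReal_zero, mul_zero, Complex.exp_zero, mul_one,
    Finset.mul_sum, Finset.sum_div]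
  exact Finset.sum_congr rfl fun k _ => by ring

lemma fundSol_zero {m : ℕ} (hm : m + 1 < n) : fundSol n z m 0 = 0 := by
  rw [fundSol_zero_eq, sum_exponent_pow_eq_zero (by omega)
    (fun h => by have := Nat.le_of_dvd (by omega) h; omega)]
  simp

lemma fundSol_zero_top (hn : n ≠ 0) (hz : z ≠ 0) :
    fundSol n z (n - 1) 0 = ((-Complex.I) ^ n)⁻¹ := by
  rw [fundSol_zero_eq, show n - 1 + 1 = n by omega, sum_exponent_pow_self, mul_div_assoc, div_self,
    mul_one]
  have : (n : ℂ) ≠ 0 := Nat.cast_ne_zero.2 hn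
  exact mul_ne_zero this (pow_ne_zero _ (mul_ne_zero Complex.I_ne_zero hz))

lemma causalSol_of_neg {m : ℕ} {t : ℝ} (ht : t < 0) : causalSol n z m t = 0 := by
  rw [causalSol, if_neg ht.not_ge]

lemma causalSol_of_nonneg {m : ℕ} {t : ℝ} (ht : 0 ≤ t) : causalSol n z m t = fundSol n z m t := by
  rw [causalSol, if_pos ht]

lemma hasDerivAt_causalSol_of_ne (m : ℕ) {t : ℝ} (ht : t ≠ 0) :
    HasDerivAt (causalSol n z m) (causalSol n z (m + 1) t) t := by
  rcases lt_or_gt_of_ne ht with h | h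
  · rw [causalSol_of_neg h]
    refine (hasDerivAt_const t (0 : ℂ)).congr_of_eventuallyEq ?_
    filter_upwards [Iio_mem_nhds h] with s hs
    exact causalSol_of_neg hs
  · rw [causalSol_of_nonneg h.le]
    refine (hasDerivAt_fundSol m t).congr_of_eventuallyEq ?_
    filter_upwards [Ioi_mem_nhds h] with s hs
    exact causalSol_of_nonneg (le_of_lt hs)

/-- At `0` the fundamental solution vanishes together with its next derivative, so it is `o(t)`, and
cutting it off for `t < 0` only decreases its modulus. Both orders `m` and `m + 1` must stay below
`n - 1`. -/
lemma hasDerivAt_causalSol {m : ℕ} (hm : m + 2 < n) (t : ℝ) :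
    HasDerivAt (causalSol n z m) (causalSol n z (m + 1) t) t := by
  rcases eq_or_ne t 0 with rfl | h
  · have h0 := hasDerivAt_fundSol (n := n) (z := z) m 0
    rw [causalSol_of_nonneg le_rfl, fundSol_zero (by omega)]
    rw [fundSol_zero (by omega), hasDerivAt_iff_isLittleO] at h0
    rw [hasDerivAt_iff_isLittleO]
    refine (Asymptotics.IsBigO.of_bound 1 (Eventually.of_forall fun s => ?_)).trans_isLittleO h0
    rw [causalSol_of_nonneg le_rfl, fundSol_zero (by omega)]
    simp only [sub_zero, smul_zero, one_mul]
    rw [causalSol]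
    split_ifs <;> simp
  · exact hasDerivAt_causalSol_of_ne m h

lemma continuous_causalSol {m : ℕ} (hm : m + 1 < n) : Continuous (causalSol n z m) := by
  refine Continuous.if_le (continuous_fundSol m) continuous_const continuous_const continuous_id
    fun t ht => ?_
  rw [← ht, fundSol_zero hm]

lemma hasDerivAt_greenCandidate {D : Fin n → ℝ → ℂ} {m : ℕ} {x ξ : ℝ}
    (h : x ≠ ξ ∨ m + 2 < n) :
    HasDerivAt (fun x => greenCandidate n z D m x ξ) (greenCandidate n z D (m + 1) x ξ) x := by
  have h1 : HasDerivAt (causalSol n z m) (causalSol n z (m + 1) (x - ξ)) (x - ξ) := by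
    rcases h with h | h
    · exact hasDerivAt_causalSol_of_ne m (sub_ne_zero.2 h)
    · exact hasDerivAt_causalSol h _
  exact (h1.comp_sub_const x ξ).add
    (hasDerivAt_sum_cexp (fun j => D j ξ) (exponent n z) m x)

lemma continuous_greenCandidate {D : Fin n → ℝ → ℂ} (hD : ∀ j, Continuous (D j)) {m : ℕ}
    (hm : m + 1 < n) : Continuous fun s : ℝ × ℝ => greenCandidate n z D m s.1 s.2 := by
  refine ((continuous_causalSol hm).comp (by fun_prop)).add ?_
  refine continuous_finsetSum _ fun j _ => ?_
  have := hD j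
  fun_prop

lemma iteratedDerivWithin_greenCandidate (hab : a < b) {D : Fin n → ℝ → ℂ} {m : ℕ} {x ξ : ℝ}
    (hx : x ∈ Icc a b) (h : m + 1 < n ∨ x ≠ ξ) :
    iteratedDerivWithin m (fun x => greenCandidate n z D 0 x ξ) (Icc a b) x =
      greenCandidate n z D m x ξ := by
  rcases h with h | h
  · exact iteratedDerivWithin_eq_of_chain (Y := fun m x => greenCandidate n z D m x ξ) hab
      isOpen_univ (N := m) (fun k hk t _ =>
        (hasDerivAt_greenCandidate (Or.inr (by omega))).hasDerivWithinAt) m le_rfl x ⟨hx, trivial⟩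
  · exact iteratedDerivWithin_eq_of_chain (Y := fun m x => greenCandidate n z D m x ξ) hab
      isOpen_compl_singleton (N := m) (fun k _ t ht =>
        (hasDerivAt_greenCandidate (Or.inl ht.2)).hasDerivWithinAt) m le_rfl x ⟨hx, h⟩

lemma greenCandidate_of_lt {D : Fin n → ℝ → ℂ} {m : ℕ} {x ξ : ℝ} (h : x < ξ) :
    greenCandidate n z D m x ξ =
      ∑ j, D j ξ * exponent n z j ^ m * Complex.exp (exponent n z j * x) := by
  rw [greenCandidate, causalSol_of_neg (sub_neg.2 h), zero_add]

lemma greenCandidate_of_ge {D : Fin n → ℝ → ℂ} {m : ℕ} {x ξ : ℝ} (h : ξ ≤ x) :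
    greenCandidate n z D m x ξ = fundSol n z m (x - ξ) +
      ∑ j, D j ξ * exponent n z j ^ m * Complex.exp (exponent n z j * x) := by
  rw [greenCandidate, causalSol_of_nonneg (sub_nonneg.2 h)]

lemma neg_I_pow_mul_I_mul_pow : (-Complex.I) ^ n * (Complex.I * z) ^ n = z ^ n := by
  rw [← mul_pow, ← mul_assoc, neg_mul, Complex.I_mul_I, neg_neg, one_mul]

lemma greenCandidate_equation {D : Fin n → ℝ → ℂ} (x ξ : ℝ) :
    (-Complex.I) ^ n * greenCandidate n z D n x ξ = z ^ n * greenCandidate n z D 0 x ξ := by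
  have h : greenCandidate n z D n x ξ = (Complex.I * z) ^ n * greenCandidate n z D 0 x ξ := by
    simp only [greenCandidate, causalSol, fundSol, exponent_pow, pow_zero, mul_one, mul_add,
      Finset.mul_sum, mul_ite, mul_zero]
    congr 1
    · congr 1
      exact Finset.sum_congr rfl fun k _ => by ring
    · exact Finset.sum_congr rfl fun k _ => by ring
  rw [h, ← mul_assoc, neg_I_pow_mul_I_mul_pow]

/-- The causal part vanishes near `a` because `a < ξ`, so it enters the boundary conditions only
through `Q` at `b`; this is the inhomogeneity in `hbc`. The jump is the value at `0` of the
derivative of order `n - 1` of the fundamental solution. -/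
theorem isGreenFunction_greenCandidate (hn : 2 ≤ n) (hab : a < b) (hz : z ≠ 0)
    (hP : ∀ r, (P r).natDegree < n) (hQ : ∀ r, (Q r).natDegree < n)
    {D : Fin n → ℝ → ℂ} (hD : ∀ j, Continuous (D j))
    (hbc : ∀ ξ ∈ Ioo a b, ∀ r, ∑ j, (D j ξ * expForm a b (P r) (Q r) (exponent n z j) +
      fundCoeff n z j * Complex.exp (exponent n z j * (b - ξ)) *
        (Q r).eval (exponent n z j)) = 0) :
    IsGreenFunction n a b P Q (z ^ n) (greenCandidate n z D 0) where
  contDiffOn ξ _ := by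
    refine contDiffOn_of_chain (Y := fun m x => greenCandidate n z D m x ξ) (uniqueDiffOn_Icc hab)
      (fun m hm x _ => (hasDerivAt_greenCandidate (Or.inr (by omega))).hasDerivWithinAt) ?_
    exact ((continuous_greenCandidate hD (by omega)).comp
      (by fun_prop : Continuous fun x : ℝ => (x, ξ))).continuousOn
  continuousOn k hk := by
    refine (continuous_greenCandidate (z := z) hD (m := k) (by omega)).continuousOn.congr ?_
    intro s hs
    exact iteratedDerivWithin_greenCandidate hab hs.1 (Or.inl (by omega))
  contDiffOn_off_diag ξ _ := by
    refine contDiffOn_of_chain (Y := fun m x => greenCandidate n z D m x ξ)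
      ((uniqueDiffOn_Icc hab).inter isOpen_compl_singleton)
      (fun m _ x hx => (hasDerivAt_greenCandidate (Or.inl hx.2)).hasDerivWithinAt) ?_
    exact fun x hx =>
      (hasDerivAt_greenCandidate (Or.inl hx.2)).continuousAt.continuousWithinAt
  equation ξ _ x hx := by
    rw [iteratedDerivWithin_greenCandidate hab hx.1 (Or.inr hx.2)]
    exact greenCandidate_equation x ξ
  jump ξ hξ := by
    set v : ℝ → ℂ := fun x => ∑ j, D j ξ * exponent n z j ^ (n - 1) *
      Complex.exp (exponent n z j * x) with hv
    have hvc : Continuous v := by fun_prop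
    refine ⟨v ξ, fundSol n z (n - 1) (ξ - ξ) + v ξ, ?_, ?_, ?_⟩
    · refine (hvc.continuousAt.mono_left nhdsWithin_le_nhds : Tendsto v (𝓝[<] ξ) _).congr' ?_
      filter_upwards [Ioo_mem_nhdsLT hξ.1] with x hx
      rw [iteratedDerivWithin_greenCandidate hab ⟨hx.1.le, (hx.2.trans hξ.2).le⟩
        (Or.inr hx.2.ne), greenCandidate_of_lt hx.2]
    · have hc : Continuous fun x => fundSol n z (n - 1) (x - ξ) + v x :=
        ((continuous_fundSol _).comp (by fun_prop)).add hvc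
      refine (hc.continuousAt.mono_left nhdsWithin_le_nhds : Tendsto _ (𝓝[>] ξ) _).congr' ?_
      filter_upwards [Ioo_mem_nhdsGT hξ.2] with x hx
      rw [iteratedDerivWithin_greenCandidate hab ⟨(hξ.1.trans hx.1).le, hx.2.le⟩
        (Or.inr hx.1.ne'), greenCandidate_of_ge hx.1.le]
    · rw [sub_self, fundSol_zero_top (by omega) hz, add_sub_cancel_right]
  boundary ξ hξ r := by
    rw [boundaryForm_eq_sum (hP r) (hQ r), ← hbc ξ hξ r]
    have h := sum_coeff_mul_eq_sum_mul_eval (hP r) (hQ r) (exponent n z)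
      (fun j => D j ξ * Complex.exp (exponent n z j * a))
      (fun j => fundCoeff n z j * Complex.exp (exponent n z j * (b - ξ)) +
        D j ξ * Complex.exp (exponent n z j * b))
    have e : ∀ j, D j ξ * expForm a b (P r) (Q r) (exponent n z j) +
        fundCoeff n z j * Complex.exp (exponent n z j * (b - ξ)) * (Q r).eval (exponent n z j) =
        D j ξ * Complex.exp (exponent n z j * a) * (P r).eval (exponent n z j) +
        (fundCoeff n z j * Complex.exp (exponent n z j * (b - ξ)) +
          D j ξ * Complex.exp (exponent n z j * b)) * (Q r).eval (exponent n z j) := by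
      intro j; rw [expForm]; ring
    simp only [e]
    rw [← h]
    refine Finset.sum_congr rfl fun m hm => ?_
    rw [iteratedDerivWithin_greenCandidate hab (left_mem_Icc.2 hab.le) (Or.inr hξ.1.ne),
      iteratedDerivWithin_greenCandidate hab (right_mem_Icc.2 hab.le) (Or.inr hξ.2.ne'),
      greenCandidate_of_lt hξ.1, greenCandidate_of_ge hξ.2.le, fundSol, ← Finset.sum_add_distrib]
    congr 2
    · exact Finset.sum_congr rfl fun j _ => by ring
    · refine Finset.sum_congr rfl fun j _ => ?_
      push_cast; ring

end Green

end TraceFormula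

namespace TraceFormula

variable {n : ℕ} {z : ℂ} {a b : ℝ} {P Q : Fin n → ℂ[X]}

/-! ### Uniqueness of the Green function -/

lemma hasDerivWithinAt_iteratedDerivWithin_off_diag (hab : a < b) {g : ℝ → ℂ} {ξ : ℝ}
    (hg : ContDiffOn ℝ n g (Icc a b \ {ξ})) {m : ℕ} (hm : m < n) {x : ℝ}
    (hx : x ∈ Icc a b \ {ξ}) :
    HasDerivWithinAt (iteratedDerivWithin m g (Icc a b))
      (iteratedDerivWithin (m + 1) g (Icc a b) x) (Icc a b) x := by
  have h1 : ContDiffWithinAt ℝ n g (Icc a b) x :=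
    (contDiffWithinAt_inter (isOpen_compl_singleton.mem_nhds hx.2)).1 (hg x hx)
  have h2 := (h1.differentiableWithinAt_iteratedDerivWithin (m := m) (by exact_mod_cast hm)
    (by rw [insert_eq_of_mem hx.1]; exact uniqueDiffOn_Icc hab)).hasDerivWithinAt
  rwa [← iteratedDerivWithin_succ] at h2

/-- The factorization of `D ^ N - κ ^ N` by `D - κ`, written for a sequence of derivatives. -/
lemma sum_telescope (κ : ℂ) (y : ℕ → ℂ) (N : ℕ) :
    ∑ m ∈ Finset.range N, κ ^ (N - 1 - m) * (y (m + 1) - κ * y m) = y N - κ ^ N * y 0 := by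
  have h : ∀ m ∈ Finset.range N, κ ^ (N - 1 - m) * (y (m + 1) - κ * y m) =
      κ ^ (N - (m + 1)) * y (m + 1) - κ ^ (N - m) * y m := by
    intro m hm
    have := Finset.mem_range.1 hm
    rw [show N - m = N - 1 - m + 1 by omega, show N - (m + 1) = N - 1 - m by omega]
    ring
  rw [Finset.sum_congr rfl h, Finset.sum_range_sub (fun m => κ ^ (N - m) * y m)]
  simp

/-- A function on `[a, b]` that solves `y^(n) = (i z)^n y` off the point `ξ`, and whose derivatives
of order less than `n` have equal one-sided limits at `ξ`, is a combination of exponentials. -/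
lemma exists_eq_sum_exponentials (hn : n ≠ 0) (hz : z ≠ 0) {ξ : ℝ}
    (hξ : ξ ∈ Ioo a b) {y : ℕ → ℝ → ℂ}
    (hd : ∀ m < n, ∀ x ∈ Icc a b \ {ξ}, HasDerivWithinAt (y m) (y (m + 1) x) (Icc a b) x)
    (heq : ∀ x ∈ Icc a b \ {ξ}, y n x = (Complex.I * z) ^ n * y 0 x)
    (hlim : ∀ m < n, ∃ l, Tendsto (y m) (𝓝[<] ξ) (𝓝 l) ∧ Tendsto (y m) (𝓝[>] ξ) (𝓝 l)) :
    ∃ v : Fin n → ℂ, ∀ m < n, ∀ x ∈ Icc a b \ {ξ},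
      y m x = ∑ k, v k * exponent n z k ^ m * Complex.exp (exponent n z k * x) := by
  set κ := exponent n z with hκ
  -- `w k` is `(D ^ n - κ ^ n) / (D - κ)` applied to `y`, with `κ = κ k`. The equation for `y`
  -- becomes `(D - κ) (w k) = 0`, so `h k` is constant on each side of `ξ`, and the matching limits
  -- make the two constants equal.
  set w : Fin n → ℝ → ℂ := fun k x => ∑ m ∈ Finset.range n, κ k ^ (n - 1 - m) * y m x with hw
  set h : Fin n → ℝ → ℂ := fun k x => w k x * Complex.exp (-κ k * x) with hh
  have hwd : ∀ k, ∀ x ∈ Icc a b \ {ξ}, HasDerivWithinAt (w k) (κ k * w k x) (Icc a b) x := by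
    intro k x hx
    have h1 : HasDerivWithinAt (w k) (∑ m ∈ Finset.range n, κ k ^ (n - 1 - m) * y (m + 1) x)
        (Icc a b) x :=
      HasDerivWithinAt.fun_sum fun m hm => (hd m (Finset.mem_range.1 hm) x hx).const_mul _
    have h2 := sum_telescope (κ k) (fun m => y m x) n
    rw [heq x hx, exponent_pow, sub_self] at h2
    have h3 : ∑ m ∈ Finset.range n, κ k ^ (n - 1 - m) * y (m + 1) x = κ k * w k x := by
      rw [← sub_eq_zero, ← h2, hw, Finset.mul_sum, ← Finset.sum_sub_distrib]
      exact Finset.sum_congr rfl fun m _ => by ring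
    rwa [h3] at h1
  have hhd : ∀ k, ∀ x ∈ Icc a b \ {ξ}, HasDerivWithinAt (h k) 0 (Icc a b) x := by
    intro k x hx
    have h1 := (hwd k x hx).mul (hasDerivAt_cexp_mul (-κ k) x).hasDerivWithinAt
    have e : κ k * w k x * Complex.exp (-κ k * x) +
        w k x * (-κ k * Complex.exp (-κ k * x)) = 0 := by ring
    rwa [e] at h1
  have hconst : ∀ k, ∀ s : Set ℝ, Convex ℝ s → s ⊆ Icc a b \ {ξ} →
      ∀ x ∈ s, ∀ t ∈ s, h k x = h k t := by
    intro k s hs hsub x hx t ht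
    have h1 := hs.norm_image_sub_le_of_norm_hasDerivWithin_le (f := h k) (f' := fun _ => 0) (C := 0)
      (fun u hu => (hhd k u (hsub hu)).mono fun _ hv => (hsub hv).1) (by simp) ht hx
    simpa [sub_eq_zero] using h1
  have hhlim : ∀ k, ∃ l, Tendsto (h k) (𝓝[<] ξ) (𝓝 l) ∧ Tendsto (h k) (𝓝[>] ξ) (𝓝 l) := by
    intro k
    choose! l hl using hlim
    have hexp : Tendsto (fun x : ℝ => Complex.exp (-κ k * x)) (𝓝 ξ)
        (𝓝 (Complex.exp (-κ k * ξ))) :=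
      Continuous.tendsto (by fun_prop) ξ
    refine ⟨(∑ m ∈ Finset.range n, κ k ^ (n - 1 - m) * l m) * Complex.exp (-κ k * ξ), ?_, ?_⟩
    · refine Tendsto.mul (tendsto_finsetSum _ fun m hm => ?_) (hexp.mono_left nhdsWithin_le_nhds)
      exact (hl m (Finset.mem_range.1 hm)).1.const_mul _
    · refine Tendsto.mul (tendsto_finsetSum _ fun m hm => ?_) (hexp.mono_left nhdsWithin_le_nhds)
      exact (hl m (Finset.mem_range.1 hm)).2.const_mul _
  choose H hH using hhlim
  have hval : ∀ k, ∀ x ∈ Icc a b \ {ξ}, h k x = H k := by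
    intro k x hx
    rcases lt_or_gt_of_ne hx.2 with hlt | hgt
    · have hsub : Ico a ξ ⊆ Icc a b \ {ξ} := fun t ht =>
        ⟨⟨ht.1, (ht.2.trans hξ.2).le⟩, ht.2.ne⟩
      refine tendsto_nhds_unique (tendsto_const_nhds.congr' ?_) (hH k).1
      filter_upwards [Ico_mem_nhdsLT hξ.1] with t ht
      exact hconst k _ (convex_Ico a ξ) hsub x ⟨hx.1.1, hlt⟩ t ht
    · have hsub : Ioc ξ b ⊆ Icc a b \ {ξ} := fun t ht =>
        ⟨⟨(hξ.1.trans ht.1).le, ht.2⟩, ht.1.ne'⟩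
      refine tendsto_nhds_unique (tendsto_const_nhds.congr' ?_) (hH k).2
      filter_upwards [Ioc_mem_nhdsGT hξ.2] with t ht
      exact hconst k _ (convex_Ioc ξ b) hsub x ⟨hgt, hx.1.2⟩ t ht
  have hc : (n * (Complex.I * z) ^ n : ℂ) ≠ 0 :=
    mul_ne_zero (Nat.cast_ne_zero.2 hn) (pow_ne_zero _ (mul_ne_zero Complex.I_ne_zero hz))
  refine ⟨fun k => κ k * H k / (n * (Complex.I * z) ^ n), fun m hm x hx => ?_⟩
  have hwval : ∀ k, w k x = H k * Complex.exp (κ k * x) := by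
    intro k
    rw [← hval k x hx, hh]
    simp only [mul_assoc, ← Complex.exp_add]
    simp
  -- Orthogonality inverts the passage from the `y m` to the `w k`.
  have h1 : ∑ k, κ k ^ (m + 1) * w k x = n * (Complex.I * z) ^ n * y m x := by
    simp only [hw, Finset.mul_sum]
    rw [Finset.sum_comm]
    simp only [← mul_assoc, ← Finset.sum_mul]
    have h2 : ∀ l ∈ Finset.range n, (∑ k, κ k ^ (m + 1) * κ k ^ (n - 1 - l)) * y l x =
        if m = l then n * (Complex.I * z) ^ n * y l x else 0 := by
      intro l hl
      rw [sum_exponent_pow_mul_pow hm (Finset.mem_range.1 hl), ite_mul, zero_mul]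
    rw [Finset.sum_congr rfl h2, Finset.sum_ite_eq, if_pos (Finset.mem_range.2 hm)]
  have h3 : y m x = (∑ k, κ k ^ (m + 1) * w k x) / (n * (Complex.I * z) ^ n) := by
    rw [h1, mul_div_cancel_left₀ _ hc]
  rw [h3, Finset.sum_div]
  refine Finset.sum_congr rfl fun k _ => ?_
  rw [hwval]
  ring

/-- In the difference of two Green functions the jumps cancel, so it is a combination of
exponentials across `ξ`; the boundary conditions and `hinj` make it zero. -/
theorem IsGreenFunction.eq_of_injective (hn : 2 ≤ n) (hab : a < b) (hz : z ≠ 0)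
    (hP : ∀ r, (P r).natDegree < n) (hQ : ∀ r, (Q r).natDegree < n)
    (hinj : ∀ v : Fin n → ℂ,
      (∀ r, ∑ j, v j * expForm a b (P r) (Q r) (exponent n z j) = 0) → v = 0)
    {G₁ G₂ : ℝ → ℝ → ℂ} (h₁ : IsGreenFunction n a b P Q (z ^ n) G₁)
    (h₂ : IsGreenFunction n a b P Q (z ^ n) G₂) {ξ : ℝ} (hξ : ξ ∈ Ioo a b) :
    G₁ ξ ξ = G₂ ξ ξ := by
  set y : ℕ → ℝ → ℂ := fun m x => iteratedDerivWithin m (fun x => G₁ x ξ) (Icc a b) x -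
    iteratedDerivWithin m (fun x => G₂ x ξ) (Icc a b) x with hy
  have hξ' : ξ ∈ Icc a b := Ioo_subset_Icc_self hξ
  have hcont : ∀ m ≤ n - 2, ContinuousAt (y m) ξ := by
    intro m hm
    have hc : ∀ G, IsGreenFunction n a b P Q (z ^ n) G →
        ContinuousAt (iteratedDerivWithin m (fun x => G x ξ) (Icc a b)) ξ := fun G hG =>
      ((hG.contDiffOn ξ hξ').continuousOn_iteratedDerivWithin (by exact_mod_cast hm)
        (uniqueDiffOn_Icc hab)).continuousAt (Icc_mem_nhds hξ.1 hξ.2)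
    exact (hc G₁ h₁).sub (hc G₂ h₂)
  have heqn : ∀ G, IsGreenFunction n a b P Q (z ^ n) G → ∀ x ∈ Icc a b \ {ξ},
      iteratedDerivWithin n (fun x => G x ξ) (Icc a b) x = (Complex.I * z) ^ n * G x ξ := by
    intro G hG x hx
    have h := hG.equation ξ hξ x hx
    rw [← neg_I_pow_mul_I_mul_pow (n := n) (z := z), mul_assoc] at h
    exact mul_left_cancel₀ (pow_ne_zero _ (neg_ne_zero.2 Complex.I_ne_zero)) h
  obtain ⟨v, hv⟩ := exists_eq_sum_exponentials (y := y) (by omega : n ≠ 0) hz hξ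
    (fun m hm x hx =>
      (hasDerivWithinAt_iteratedDerivWithin_off_diag hab (h₁.contDiffOn_off_diag ξ hξ) hm hx).sub
      (hasDerivWithinAt_iteratedDerivWithin_off_diag hab (h₂.contDiffOn_off_diag ξ hξ) hm hx))
    (fun x hx => by
      simp only [hy, iteratedDerivWithin_zero, heqn G₁ h₁ x hx, heqn G₂ h₂ x hx, mul_sub])
    (fun m hm => by
      rcases Nat.lt_or_ge m (n - 1) with h | h
      · have hc := hcont m (by omega)
        exact ⟨y m ξ, hc.tendsto.mono_left nhdsWithin_le_nhds,
          hc.tendsto.mono_left nhdsWithin_le_nhds⟩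
      · obtain rfl : m = n - 1 := by omega
        obtain ⟨l₁, r₁, hl₁, hr₁, hj₁⟩ := h₁.jump ξ hξ
        obtain ⟨l₂, r₂, hl₂, hr₂, hj₂⟩ := h₂.jump ξ hξ
        refine ⟨l₁ - l₂, hl₁.sub hl₂, ?_⟩
        rw [show l₁ - l₂ = r₁ - r₂ by linear_combination hj₂ - hj₁]
        exact hr₁.sub hr₂)
  have hv0 : v = 0 := by
    refine hinj v fun r => ?_
    have e1 := h₁.boundary ξ hξ r
    have e2 := h₂.boundary ξ hξ r
    rw [boundaryForm_eq_sum (hP r) (hQ r)] at e1 e2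
    have e3 : ∑ m ∈ Finset.range n, ((P r).coeff m * y m a + (Q r).coeff m * y m b) = 0 := by
      rw [← sub_eq_zero.2 (e1.trans e2.symm), ← Finset.sum_sub_distrib]
      refine Finset.sum_congr rfl fun m _ => ?_
      simp only [hy]
      ring
    have e4 := sum_coeff_mul_eq_sum_mul_eval (hP r) (hQ r) (exponent n z)
      (fun j => v j * Complex.exp (exponent n z j * a))
      (fun j => v j * Complex.exp (exponent n z j * b))
    have e5 : ∑ j, v j * expForm a b (P r) (Q r) (exponent n z j) =
        ∑ j, (v j * Complex.exp (exponent n z j * a) * (P r).eval (exponent n z j) +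
          v j * Complex.exp (exponent n z j * b) * (Q r).eval (exponent n z j)) :=
      Finset.sum_congr rfl fun j _ => by rw [expForm]; ring
    rw [e5, ← e4, ← e3]
    refine Finset.sum_congr rfl fun m hm => ?_
    rw [hv m (Finset.mem_range.1 hm) a ⟨left_mem_Icc.2 hab.le, hξ.1.ne⟩,
      hv m (Finset.mem_range.1 hm) b ⟨right_mem_Icc.2 hab.le, hξ.2.ne'⟩]
    congr 2 <;> exact Finset.sum_congr rfl fun j _ => by ring
  -- The exponential representation holds off `ξ` only; the value at `ξ` follows by continuity,
  -- order `0` being at most `n - 2`.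
  have h0 : y 0 ξ = 0 := by
    refine tendsto_nhds_unique ((hcont 0 (by omega)).tendsto.mono_left
      (nhdsWithin_le_nhds (s := Iio ξ))) (tendsto_const_nhds.congr' ?_)
    filter_upwards [Ico_mem_nhdsLT hξ.1] with t ht
    rw [hv 0 (by omega) t ⟨⟨ht.1, (ht.2.trans hξ.2).le⟩, ht.2.ne⟩, hv0]
    simp
  simpa [hy, sub_eq_zero] using h0

/-! ### Zeros of the characteristic determinant are eigenvalues -/

theorem mem_eigenvalues_of_expForm (hab : a < b) (hz : z ≠ 0)
    (hP : ∀ r, (P r).natDegree < n) (hQ : ∀ r, (Q r).natDegree < n)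
    {v : Fin n → ℂ} (hv : v ≠ 0)
    (hbc : ∀ r, ∑ j, v j * expForm a b (P r) (Q r) (exponent n z j) = 0) :
    z ^ n ∈ eigenvalues n a b 0 P Q := by
  set κ := exponent n z with hκ
  set Y : ℕ → ℝ → ℂ := fun m x => ∑ j, v j * κ j ^ m * Complex.exp (κ j * x) with hY
  have hder : ∀ m x, HasDerivAt (Y m) (Y (m + 1) x) x := fun m x => hasDerivAt_sum_cexp v κ m x
  have hcont : ∀ m, Continuous (Y m) := fun m =>
    continuous_iff_continuousAt.2 fun x => (hder m x).continuousAt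
  have hit : ∀ m, ∀ x ∈ Icc a b, iteratedDerivWithin m (Y 0) (Icc a b) x = Y m x := fun m x hx =>
    iteratedDerivWithin_eq_of_chain hab isOpen_univ (N := m)
      (fun k _ t _ => (hder k t).hasDerivWithinAt) m le_rfl x ⟨hx, trivial⟩
  refine ⟨Y 0, ?_, ?_, ?_, ?_, fun r => ?_⟩
  -- If the combination vanished on `[a, b]`, so would all its derivatives at `a`, and a Vandermonde
  -- system would force `v = 0`.
  · by_contra hcon
    push Not at hcon
    have ha : a ∈ Icc a b := left_mem_Icc.2 hab.le
    have h0 : ∀ m, Y m a = 0 := by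
      intro m
      rw [← hit m a ha, iteratedDerivWithin_congr (g := fun _ => (0 : ℂ)) (fun x hx => hcon x hx) ha]
      simp
    have h1 := eq_zero_of_sum_mul_exponent_pow hz
      (v := fun j => v j * Complex.exp (κ j * a)) fun m _ => by
        rw [← h0 m]
        exact Finset.sum_congr rfl fun j _ => by ring
    refine hv (funext fun j => ?_)
    have h2 := congrFun h1 j
    simpa [Complex.exp_ne_zero] using h2
  · exact contDiffOn_of_chain (uniqueDiffOn_Icc hab) (fun m _ x _ => (hder m x).hasDerivWithinAt)
      (hcont _).continuousOn
  · obtain ⟨C, hC⟩ := isCompact_Icc.exists_bound_of_continuousOn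
      ((hcont (n - 1 + 1)).continuousOn (s := Icc a b))
    have hlip : LipschitzOnWith C.toNNReal (iteratedDerivWithin (n - 1) (Y 0) (Icc a b))
        (uIcc a b) := by
      rw [uIcc_of_le hab.le]
      refine (convex_Icc a b).lipschitzOnWith_of_nnnorm_hasDerivWithin_le
        (f' := Y (n - 1 + 1)) (fun x hx => ?_) (fun x hx => ?_)
      · exact (hder (n - 1) x).hasDerivWithinAt.congr (fun t ht => hit _ t ht) (hit _ x hx)
      · rw [← NNReal.coe_le_coe, coe_nnnorm]
        exact (hC x hx).trans (Real.le_coe_toNNReal C)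
    exact hlip.absolutelyContinuousOnInterval
  · filter_upwards [ae_restrict_mem measurableSet_Icc] with x hx
    have e : Y n x = (Complex.I * z) ^ n * Y 0 x := by
      simp only [hY, hκ, exponent_pow, pow_zero, mul_one, Finset.mul_sum]
      exact Finset.sum_congr rfl fun k _ => by ring
    rw [hit n x hx, e, ← mul_assoc, neg_I_pow_mul_I_mul_pow]
    simp
  · rw [boundaryForm_eq_sum (hP r) (hQ r), ← hbc r]
    have e4 := sum_coeff_mul_eq_sum_mul_eval (hP r) (hQ r) κ
      (fun j => v j * Complex.exp (κ j * a)) (fun j => v j * Complex.exp (κ j * b))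
    have e5 : ∑ j, v j * expForm a b (P r) (Q r) (κ j) =
        ∑ j, (v j * Complex.exp (κ j * a) * (P r).eval (κ j) +
          v j * Complex.exp (κ j * b) * (Q r).eval (κ j)) :=
      Finset.sum_congr rfl fun j _ => by rw [expForm]; ring
    rw [e5, ← e4]
    refine Finset.sum_congr rfl fun m _ => ?_
    rw [hit m a (left_mem_Icc.2 hab.le), hit m b (right_mem_Icc.2 hab.le)]
    congr 2 <;> exact Finset.sum_congr rfl fun j _ => by ring

end TraceFormula

namespace TraceFormula

/-! ### Perturbation of determinants -/

section Det

variable {n : ℕ}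

lemma exists_norm_det_sub_le (B : ℝ) {ω : ℝ} (hω : 0 < ω) :
    ∃ τ > 0, ∀ X Y : Matrix (Fin n) (Fin n) ℂ, (∀ i j, ‖X i j‖ ≤ B) → (∀ i j, ‖Y i j‖ ≤ B) →
      (∀ i j, ‖X i j - Y i j‖ ≤ τ) → ‖X.det - Y.det‖ ≤ ω := by
  have hc : Continuous fun X : Fin n → Fin n → ℂ => Matrix.det (Matrix.of X) := by
    refine Continuous.matrix_det ?_
    exact continuous_id
  have hB : IsCompact (Metric.closedBall (0 : Fin n → Fin n → ℂ) (max B 0)) :=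
    isCompact_closedBall _ _
  have hu := hB.uniformContinuousOn_of_continuous hc.continuousOn
  obtain ⟨δ, hδ, h⟩ := Metric.uniformContinuousOn_iff.1 hu ω hω
  have hmem : ∀ X : Matrix (Fin n) (Fin n) ℂ, (∀ i j, ‖X i j‖ ≤ B) →
      (fun i j => X i j) ∈ Metric.closedBall (0 : Fin n → Fin n → ℂ) (max B 0) := by
    intro X hX
    rw [mem_closedBall_zero_iff, pi_norm_le_iff_of_nonneg (le_max_right _ _)]
    intro i
    rw [pi_norm_le_iff_of_nonneg (le_max_right _ _)]
    exact fun j => (hX i j).trans (le_max_left _ _)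
  refine ⟨δ / 2, half_pos hδ, fun X Y hX hY hXY => ?_⟩
  have h1 : dist (fun i j => X i j) (fun i j => Y i j) < δ := by
    refine lt_of_le_of_lt ?_ (half_lt_self hδ)
    rw [dist_pi_le_iff (half_pos hδ).le]
    intro i
    rw [dist_pi_le_iff (half_pos hδ).le]
    intro j
    rw [dist_eq_norm]
    exact hXY i j
  have h2 := h _ (hmem X hX) _ (hmem Y hY) h1
  rw [dist_eq_norm] at h2
  exact h2.le

/-- Cramer's rule: the adjugate is continuous, hence bounded on bounded sets of matrices. -/
lemma exists_norm_inv_le (B : ℝ) {η : ℝ} (hη : 0 < η) :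
    ∃ C > 0, ∀ X : Matrix (Fin n) (Fin n) ℂ, (∀ i j, ‖X i j‖ ≤ B) → η ≤ ‖X.det‖ →
      ∀ i j, ‖X⁻¹ i j‖ ≤ C := by
  have hc : Continuous fun X : Fin n → Fin n → ℂ =>
      (fun i j => Matrix.adjugate (Matrix.of X) i j : Fin n → Fin n → ℂ) := by
    have : Continuous fun X : Fin n → Fin n → ℂ => Matrix.adjugate (Matrix.of X) :=
      Continuous.matrix_adjugate continuous_id
    exact this
  have hB : IsCompact (Metric.closedBall (0 : Fin n → Fin n → ℂ) (max B 0)) :=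
    isCompact_closedBall _ _
  obtain ⟨C, hC⟩ := hB.exists_bound_of_continuousOn hc.continuousOn
  refine ⟨(|C| + 1) / η, by positivity, fun X hX hdet i j => ?_⟩
  have hmem : (fun i j => X i j) ∈ Metric.closedBall (0 : Fin n → Fin n → ℂ) (max B 0) := by
    rw [mem_closedBall_zero_iff, pi_norm_le_iff_of_nonneg (le_max_right _ _)]
    intro i
    rw [pi_norm_le_iff_of_nonneg (le_max_right _ _)]
    exact fun j => (hX i j).trans (le_max_left _ _)
  have h1 : ‖X.adjugate i j‖ ≤ C :=
    ((norm_le_pi_norm _ j).trans (norm_le_pi_norm _ i)).trans (hC _ hmem)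
  rw [Matrix.inv_def, Matrix.smul_apply, smul_eq_mul, norm_mul, Ring.inverse_eq_inv', norm_inv]
  rw [div_eq_inv_mul]
  have h2 : ‖X.adjugate i j‖ ≤ |C| + 1 := by linarith [le_abs_self C]
  gcongr

/-- A minimum principle for zero-free holomorphic functions on a disc. -/
lemma le_norm_center_of_le_norm_sphere {f : ℂ → ℂ} {z : ℂ} {r m : ℝ} (hr : 0 < r) (hm : 0 < m)
    (hd : DiffContOnCl ℂ f (Metric.ball z r)) (hne : ∀ w ∈ Metric.closedBall z r, f w ≠ 0)
    (hs : ∀ w ∈ Metric.sphere z r, m ≤ ‖f w‖) : m ≤ ‖f z‖ := by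
  have hcl : closure (Metric.ball z r) = Metric.closedBall z r := closure_ball z hr.ne'
  have h1 : DiffContOnCl ℂ (fun w => (f w)⁻¹) (Metric.ball z r) :=
    hd.inv fun w hw => hne w (hcl ▸ hw)
  have h2 := Complex.norm_le_of_forall_mem_frontier_norm_le Metric.isBounded_ball h1
    (C := m⁻¹) (fun w hw => by
      rw [frontier_ball z hr.ne'] at hw
      rw [norm_inv]
      exact inv_anti₀ hm (hs w hw)) (z := z) (subset_closure (Metric.mem_ball_self hr))
  rw [norm_inv] at h2
  exact (inv_le_inv₀ (norm_pos_iff.2 (hne z (Metric.mem_closedBall_self hr.le))) hm).1 h2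

end Det

/-! ### The characteristic matrix -/

section CharMatrix

open Bornology

variable {n : ℕ}

lemma tendsto_eval_div_pow {R : ℂ[X]} {d : ℕ} (h : R.natDegree ≤ d) :
    Tendsto (fun x : ℂ => R.eval x / x ^ d) (cobounded ℂ) (𝓝 (R.coeff d)) := by
  have hne : ∀ᶠ x : ℂ in cobounded ℂ, x ≠ 0 := eventually_ne_cobounded 0
  have h1 : ∀ i ∈ Finset.range (d + 1), Tendsto (fun x : ℂ => R.coeff i * (x ^ i / x ^ d))
      (cobounded ℂ) (𝓝 (if d = i then R.coeff i else 0)) := by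
    intro i hi
    have hi' : i ≤ d := Nat.lt_succ_iff.1 (Finset.mem_range.1 hi)
    split_ifs with hd
    · subst hd
      refine tendsto_const_nhds.congr' ?_
      filter_upwards [hne] with x hx
      rw [div_self (pow_ne_zero _ hx), mul_one]
    · have h2 : Tendsto (fun x : ℂ => R.coeff i * x⁻¹ ^ (d - i)) (cobounded ℂ) (𝓝 0) := by
        have := ((tendsto_inv₀_cobounded (α := ℂ)).pow (d - i)).const_mul (R.coeff i)
        rwa [zero_pow (by omega), mul_zero] at this
      refine h2.congr' ?_
      filter_upwards [hne] with x hx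
      rw [inv_pow]
      congr 1
      rw [eq_div_iff (pow_ne_zero _ hx), inv_mul_eq_iff_eq_mul₀ (pow_ne_zero _ hx), ← pow_add]
      congr 1
      omega
  have h3 := tendsto_finsetSum _ h1
  rw [Finset.sum_ite_eq, if_pos (Finset.mem_range.2 (Nat.lt_succ_self d))] at h3
  refine h3.congr fun x => ?_
  rw [Polynomial.eval_eq_sum_range' (Nat.lt_succ_of_le h), Finset.sum_div]
  exact Finset.sum_congr rfl fun i _ => by ring

/-- Since `κ_k = (i z) ρ ^ k`, dividing by `(i z) ^ d` instead of `κ_k ^ d` leaves the factor `ρ ^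
(k d)`; these limits are the entries of the Birkhoff matrix. -/
lemma tendsto_eval_exponent_div {R : ℂ[X]} {d : ℕ} (h : R.natDegree ≤ d) (k : Fin n) :
    Tendsto (fun z : ℂ => R.eval (exponent n z k) / (Complex.I * z) ^ d) (cobounded ℂ)
      (𝓝 (R.coeff d * unityRoot n ^ ((k : ℕ) * d))) := by
  have h1 : Tendsto (fun z : ℂ => exponent n z k) (cobounded ℂ) (cobounded ℂ) := by
    rw [← tendsto_norm_atTop_iff_cobounded]
    simp only [norm_exponent]
    exact tendsto_norm_cobounded_atTop
  have h2 := ((tendsto_eval_div_pow h).comp h1).mul_const (unityRoot n ^ ((k : ℕ) * d))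
  refine h2.congr fun z => ?_
  have hρ : unityRoot n ^ ((k : ℕ) * d) ≠ 0 := pow_ne_zero _ (Complex.exp_ne_zero _)
  simp only [Function.comp_apply]
  rw [show exponent n z k ^ d = (Complex.I * z) ^ d * unityRoot n ^ ((k : ℕ) * d) by
    rw [exponent, mul_pow, pow_mul], div_mul_eq_mul_div, mul_div_mul_right _ _ hρ]

/-- The end point at which the `k`-th exponential is normalized: `a` for `k < ν`, else `b`. -/
def nearEnd (a b : ℝ) (ν : ℕ) (k : Fin n) : ℝ := if (k : ℕ) < ν then a else b

/-- The end point opposite to `nearEnd`. -/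
def farEnd (a b : ℝ) (ν : ℕ) (k : Fin n) : ℝ := if (k : ℕ) < ν then b else a

/-- The value at `farEnd` of the `k`-th exponential normalized at `nearEnd`. -/
noncomputable def tailExp (a b : ℝ) (ν : ℕ) (z : ℂ) (k : Fin n) : ℂ :=
  Complex.exp (exponent n z k * ((farEnd a b ν k : ℂ) - nearEnd a b ν k))

/-- The characteristic matrix of the boundary conditions: the boundary forms of the exponentials
normalized at `nearEnd`, each row divided by `(i z) ^ d` with `d` the order of the condition. -/
noncomputable def charMatrix (a b : ℝ) (P Q : Fin n → ℂ[X]) (ν : ℕ) (z : ℂ) :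
    Matrix (Fin n) (Fin n) ℂ :=
  Matrix.of fun r k =>
    ((if (k : ℕ) < ν then P r else Q r).eval (exponent n z k) +
      (if (k : ℕ) < ν then Q r else P r).eval (exponent n z k) * tailExp a b ν z k) /
      (Complex.I * z) ^ bcOrder (P r) (Q r)

/-- The coefficients complementary to those of `birkhoffMatrix`. -/
noncomputable def dualBirkhoffMatrix (P Q : Fin n → ℂ[X]) (ν : ℕ) : Matrix (Fin n) (Fin n) ℂ :=
  Matrix.of fun r k =>
    (if (k : ℕ) < ν then Q r else P r).coeff (bcOrder (P r) (Q r)) *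
      unityRoot n ^ ((k : ℕ) * bcOrder (P r) (Q r))

lemma birkhoffMatrix_apply (P Q : Fin n → ℂ[X]) (ν : ℕ) (r k : Fin n) :
    birkhoffMatrix P Q ν r k =
      (if (k : ℕ) < ν then P r else Q r).coeff (bcOrder (P r) (Q r)) *
        unityRoot n ^ ((k : ℕ) * bcOrder (P r) (Q r)) := by
  rw [birkhoffMatrix, Matrix.of_apply, unityRoot]
  split_ifs <;> rfl

variable {a b : ℝ} {P Q : Fin n → ℂ[X]} {ν : ℕ}

/-- For `z ≠ 0` the characteristic matrix differs from the matrix of raw boundary forms only by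
nonzero row and column factors, so both are singular at the same `z`, whatever `ν` is. -/
lemma charMatrix_apply_eq_expForm (z : ℂ) (r k : Fin n) :
    charMatrix a b P Q ν z r k =
      Complex.exp (-(exponent n z k * nearEnd a b ν k)) *
        expForm a b (P r) (Q r) (exponent n z k) / (Complex.I * z) ^ bcOrder (P r) (Q r) := by
  rw [charMatrix, Matrix.of_apply, tailExp, expForm, mul_add]
  simp only [nearEnd, farEnd]
  congr 1
  split_ifs <;>
  · rw [mul_left_comm, mul_left_comm _ (Polynomial.eval _ _), ← Complex.exp_add, ← Complex.exp_add]
    simp only [neg_add_cancel, Complex.exp_zero, mul_one]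
    ring_nf

/-- Uniform asymptotics of the two parts of the characteristic matrix. -/
lemma exists_charMatrix_parts_approx (P Q : Fin n → ℂ[X]) (ν : ℕ) {τ : ℝ} (hτ : 0 < τ) :
    ∃ R₀ > 0, ∀ z : ℂ, R₀ ≤ ‖z‖ → ∀ r k : Fin n,
      ‖(if (k : ℕ) < ν then P r else Q r).eval (exponent n z k) /
        (Complex.I * z) ^ bcOrder (P r) (Q r) - birkhoffMatrix P Q ν r k‖ ≤ τ ∧
      ‖(if (k : ℕ) < ν then Q r else P r).eval (exponent n z k) /
        (Complex.I * z) ^ bcOrder (P r) (Q r) - dualBirkhoffMatrix P Q ν r k‖ ≤ τ := by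
  have h : ∀ᶠ z : ℂ in cobounded ℂ, ∀ r k : Fin n,
      ‖(if (k : ℕ) < ν then P r else Q r).eval (exponent n z k) /
        (Complex.I * z) ^ bcOrder (P r) (Q r) - birkhoffMatrix P Q ν r k‖ ≤ τ ∧
      ‖(if (k : ℕ) < ν then Q r else P r).eval (exponent n z k) /
        (Complex.I * z) ^ bcOrder (P r) (Q r) - dualBirkhoffMatrix P Q ν r k‖ ≤ τ := by
    rw [eventually_all]; intro r
    rw [eventually_all]; intro k
    have hPd : (P r).natDegree ≤ bcOrder (P r) (Q r) := le_max_left _ _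
    have hQd : (Q r).natDegree ≤ bcOrder (P r) (Q r) := le_max_right _ _
    rw [birkhoffMatrix_apply, dualBirkhoffMatrix, Matrix.of_apply]
    refine Eventually.and ?_ ?_
    · have h1 := tendsto_eval_exponent_div (n := n)
        (R := if (k : ℕ) < ν then P r else Q r) (by split_ifs; exacts [hPd, hQd]) k
      filter_upwards [Metric.tendsto_nhds.1 h1 τ hτ] with z hz
      rw [dist_eq_norm] at hz
      exact hz.le
    · have h1 := tendsto_eval_exponent_div (n := n)
        (R := if (k : ℕ) < ν then Q r else P r) (by split_ifs; exacts [hQd, hPd]) k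
      filter_upwards [Metric.tendsto_nhds.1 h1 τ hτ] with z hz
      rw [dist_eq_norm] at hz
      exact hz.le
  obtain ⟨R₀, -, hR₀⟩ := (hasBasis_cobounded_norm (E := ℂ)).eventually_iff.1 h
  exact ⟨max R₀ 1, by positivity, fun z hz => hR₀ ((le_max_left _ _).trans hz)⟩

lemma differentiableAt_det_charMatrix {z : ℂ} (hz : z ≠ 0) :
    DifferentiableAt ℂ (fun z => (charMatrix a b P Q ν z).det) z := by
  have hent : ∀ r k : Fin n, DifferentiableAt ℂ (fun z => charMatrix a b P Q ν z r k) z := by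
    intro r k
    have hexp : DifferentiableAt ℂ (fun z => exponent n z k) z := by
      unfold exponent; fun_prop
    have hev : ∀ R : ℂ[X], DifferentiableAt ℂ (fun z => R.eval (exponent n z k)) z := fun R =>
      (R.differentiable.differentiableAt).comp z hexp
    simp only [charMatrix, Matrix.of_apply, tailExp]
    refine DifferentiableAt.div ((hev _).add ((hev _).mul (hexp.mul_const _).cexp)) (by fun_prop) ?_
    exact pow_ne_zero _ (mul_ne_zero Complex.I_ne_zero hz)
  simp only [Matrix.det_apply]
  refine DifferentiableAt.fun_sum fun σ _ => DifferentiableAt.const_smul ?_ _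
  exact DifferentiableAt.fun_finsetProd fun i _ => hent _ _

end CharMatrix

end TraceFormula

namespace TraceFormula

/-! ### Lower bound for the characteristic determinant -/

variable {n : ℕ} {a b : ℝ} {ν : ℕ}

/-- The exponentials with index `k < ν` do not grow and those with `k ≥ ν` do not decay, and at
most one of them, with index `k₀`, changes at a rate slower than `c ‖z‖`. -/
structure HasDichotomy (n ν : ℕ) (c : ℝ) (z : ℂ) (k₀ : Fin n) : Prop where
  re_nonpos : ∀ k : Fin n, (k : ℕ) < ν → (exponent n z k).re ≤ 0
  re_nonneg : ∀ k : Fin n, ν ≤ (k : ℕ) → 0 ≤ (exponent n z k).re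
  gap : ∀ k ≠ k₀, c * ‖z‖ ≤ |(exponent n z k).re|

lemma abs_farEnd_sub_nearEnd (hab : a ≤ b) (k : Fin n) :
    |farEnd a b ν k - nearEnd a b ν k| = b - a := by
  rw [farEnd, nearEnd]
  split_ifs
  · exact abs_of_nonneg (sub_nonneg.2 hab)
  · rw [abs_sub_comm]; exact abs_of_nonneg (sub_nonneg.2 hab)

lemma HasDichotomy.norm_tailExp {c : ℝ} {z : ℂ} {k₀ : Fin n} (h : HasDichotomy n ν c z k₀)
    (k : Fin n) :
    ‖tailExp a b ν z k‖ = Real.exp (-(|(exponent n z k).re| * (b - a))) := by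
  rw [tailExp, Complex.norm_exp]
  congr 1
  rw [← Complex.ofReal_sub, Complex.re_mul_ofReal, farEnd, nearEnd]
  split_ifs with hk
  · rw [abs_of_nonpos (h.re_nonpos k hk)]; ring
  · rw [abs_of_nonneg (h.re_nonneg k (not_lt.1 hk))]; ring

lemma HasDichotomy.norm_tailExp_le_one (hab : a ≤ b) {c : ℝ} {z : ℂ} {k₀ : Fin n}
    (h : HasDichotomy n ν c z k₀) (k : Fin n) : ‖tailExp a b ν z k‖ ≤ 1 := by
  rw [h.norm_tailExp, Real.exp_le_one_iff, neg_nonpos]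
  have := sub_nonneg.2 hab
  positivity

lemma HasDichotomy.norm_tailExp_le (hab : a ≤ b) {c : ℝ} {z : ℂ} {k₀ : Fin n}
    (h : HasDichotomy n ν c z k₀) {k : Fin n} (hk : k ≠ k₀) :
    ‖tailExp a b ν z k‖ ≤ Real.exp (-(c * ‖z‖ * (b - a))) := by
  rw [h.norm_tailExp, Real.exp_le_exp, neg_le_neg_iff]
  have := sub_nonneg.2 hab
  gcongr
  exact h.gap k hk

lemma tailExp_eq_mul (z w : ℂ) (k : Fin n) :
    tailExp a b ν w k = tailExp a b ν z k * tailExp a b ν (w - z) k := by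
  rw [tailExp, tailExp, tailExp, ← Complex.exp_add]
  congr 1
  simp only [exponent]
  ring

lemma norm_tailExp_arg (hab : a ≤ b) (s : ℂ) (k : Fin n) :
    ‖exponent n s k * ((farEnd a b ν k : ℂ) - nearEnd a b ν k)‖ = ‖s‖ * (b - a) := by
  rw [norm_mul, norm_exponent, ← Complex.ofReal_sub, Complex.norm_real, Real.norm_eq_abs,
    abs_farEnd_sub_nearEnd hab]

lemma norm_exp_sub_one_ge {u : ℂ} (hu : ‖u‖ ≤ 1 / 2) : ‖u‖ / 2 ≤ ‖Complex.exp u - 1‖ := by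
  have h1 := Complex.norm_exp_sub_one_sub_id_le (x := u) (by linarith)
  have h2 : ‖u‖ ≤ ‖Complex.exp u - 1‖ + ‖Complex.exp u - 1 - u‖ := by
    calc ‖u‖ = ‖(Complex.exp u - 1) - (Complex.exp u - 1 - u)‖ := by congr 1; ring
      _ ≤ _ := norm_sub_le _ _
  nlinarith [norm_nonneg u]

lemma norm_exp_le_two {u : ℂ} (hu : ‖u‖ ≤ 1 / 2) : ‖Complex.exp u‖ ≤ 2 := by
  have h1 := Complex.norm_exp_sub_one_sub_id_le (x := u) (by linarith)
  have h2 : ‖Complex.exp u‖ ≤ ‖Complex.exp u - 1 - u‖ + ‖1 + u‖ := by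
    calc ‖Complex.exp u‖ = ‖(Complex.exp u - 1 - u) + (1 + u)‖ := by congr 1; ring
      _ ≤ _ := norm_add_le _ _
  have h3 : ‖1 + u‖ ≤ 1 + ‖u‖ := by simpa using norm_add_le (1 : ℂ) u
  nlinarith [norm_nonneg u]

/-- The coefficient of the neutral exponential in the asymptotics of the determinant. -/
noncomputable def dualDet (P Q : Fin n → ℂ[X]) (ν : ℕ) (k₀ : Fin n) : ℂ :=
  ((birkhoffMatrix P Q ν).updateCol k₀ fun r => dualBirkhoffMatrix P Q ν r k₀).det

lemma exists_entry_bound (M : Matrix (Fin n) (Fin n) ℂ) : ∃ C > 0, ∀ i j, ‖M i j‖ ≤ C := by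
  refine ⟨∑ i, ∑ j, ‖M i j‖ + 1, by positivity, fun i j => ?_⟩
  have h1 : ‖M i j‖ ≤ ∑ j, ‖M i j‖ :=
    Finset.single_le_sum (f := fun j => ‖M i j‖) (fun _ _ => norm_nonneg _) (Finset.mem_univ j)
  have h2 : ∑ j, ‖M i j‖ ≤ ∑ i, ∑ j, ‖M i j‖ :=
    Finset.single_le_sum (f := fun i => ∑ j, ‖M i j‖)
      (fun _ _ => Finset.sum_nonneg fun _ _ => norm_nonneg _) (Finset.mem_univ i)
  linarith

lemma charMatrix_apply (P Q : Fin n → ℂ[X]) (z : ℂ) (r k : Fin n) :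
    charMatrix a b P Q ν z r k =
      (if (k : ℕ) < ν then P r else Q r).eval (exponent n z k) /
        (Complex.I * z) ^ bcOrder (P r) (Q r) +
      (if (k : ℕ) < ν then Q r else P r).eval (exponent n z k) /
        (Complex.I * z) ^ bcOrder (P r) (Q r) * tailExp a b ν z k := by
  rw [charMatrix, Matrix.of_apply]; ring

/-- All columns but the `k₀`-th are close to Birkhoff columns, since their tails are small; the
`k₀`-th is close to the Birkhoff column plus `e` times the dual one, and the determinant is linear
in it. The tail bound is `2` rather than `1` because the estimate is used on a disc around the point
of interest. -/
lemma exists_det_charMatrix_approx (a b : ℝ) (P Q : Fin n → ℂ[X]) (ν : ℕ) {ω : ℝ} (hω : 0 < ω) :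
    ∃ R₀ > 0, ∃ τ > 0, ∀ z : ℂ, R₀ ≤ ‖z‖ → ∀ k₀ : Fin n, ‖tailExp a b ν z k₀‖ ≤ 2 →
      (∀ k ≠ k₀, ‖tailExp a b ν z k‖ ≤ τ) →
      ‖(charMatrix a b P Q ν z).det -
        ((birkhoffMatrix P Q ν).det + tailExp a b ν z k₀ * dualDet P Q ν k₀)‖ ≤ ω := by
  obtain ⟨C₁, hC₁, h₁⟩ := exists_entry_bound (birkhoffMatrix P Q ν)
  obtain ⟨C₂, hC₂, h₂⟩ := exists_entry_bound (dualBirkhoffMatrix P Q ν)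
  obtain ⟨τ₀, hτ₀, hdet⟩ := exists_norm_det_sub_le (n := n) (C₁ + 1 + (C₂ + 1) * 2) hω
  have hτ' : 0 < min 1 (τ₀ / 4) := by positivity
  obtain ⟨R₀, hR₀, happ⟩ := exists_charMatrix_parts_approx P Q ν hτ'
  -- Dual entries are at most `C₂ + 1`, so a tail this small changes an entry by at most `τ₀ / 4`.
  refine ⟨R₀, hR₀, min 1 (τ₀ / (4 * (C₂ + 1))), by positivity, fun z hz k₀ he hk => ?_⟩
  set e := tailExp a b ν z k₀ with he_def
  set Y := (birkhoffMatrix P Q ν).updateCol k₀ fun r =>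
    birkhoffMatrix P Q ν r k₀ + e * dualBirkhoffMatrix P Q ν r k₀ with hY
  have hYdet : Y.det = (birkhoffMatrix P Q ν).det + e * dualDet P Q ν k₀ := by
    have h3 : (fun r => birkhoffMatrix P Q ν r k₀ + e * dualBirkhoffMatrix P Q ν r k₀) =
        (fun r => birkhoffMatrix P Q ν r k₀) + e • fun r => dualBirkhoffMatrix P Q ν r k₀ := by
      ext r; simp
    rw [hY, h3, Matrix.det_updateCol_add, Matrix.det_updateCol_smul, dualDet,
      Matrix.updateCol_eq_self]
  rw [← hYdet]
  have htail : ∀ k : Fin n, ‖tailExp a b ν z k‖ ≤ 2 := by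
    intro k
    by_cases h : k = k₀
    · rw [h]; exact he
    · exact (hk k h).trans ((min_le_left _ _).trans (by norm_num))
  have hmain : ∀ r k : Fin n, ‖(if (k : ℕ) < ν then P r else Q r).eval (exponent n z k) /
        (Complex.I * z) ^ bcOrder (P r) (Q r)‖ ≤ C₁ + 1 := fun r k => by
    have := norm_le_norm_add_norm_sub' ((if (k : ℕ) < ν then P r else Q r).eval (exponent n z k) /
        (Complex.I * z) ^ bcOrder (P r) (Q r)) (birkhoffMatrix P Q ν r k)
    have h3 := (happ z hz r k).1.trans (min_le_left _ _)
    linarith [h₁ r k]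
  have hdual : ∀ r k : Fin n, ‖(if (k : ℕ) < ν then Q r else P r).eval (exponent n z k) /
        (Complex.I * z) ^ bcOrder (P r) (Q r)‖ ≤ C₂ + 1 := fun r k => by
    have := norm_le_norm_add_norm_sub' ((if (k : ℕ) < ν then Q r else P r).eval (exponent n z k) /
        (Complex.I * z) ^ bcOrder (P r) (Q r)) (dualBirkhoffMatrix P Q ν r k)
    have h3 := (happ z hz r k).2.trans (min_le_left _ _)
    linarith [h₂ r k]
  refine hdet _ _ (fun r k => ?_) (fun r k => ?_) (fun r k => ?_)
  · rw [charMatrix_apply]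
    refine (norm_add_le _ _).trans (add_le_add (hmain r k) ?_)
    rw [norm_mul]
    exact mul_le_mul (hdual r k) (htail k) (norm_nonneg _) (by positivity)
  · rw [hY]
    by_cases h : k = k₀
    · subst h
      rw [Matrix.updateCol_self]
      refine (norm_add_le _ _).trans ?_
      rw [norm_mul]
      have : ‖e‖ * ‖dualBirkhoffMatrix P Q ν r k‖ ≤ 2 * C₂ :=
        mul_le_mul he (h₂ r k) (norm_nonneg _) (by norm_num)
      linarith [h₁ r k]
    · rw [Matrix.updateCol_ne h]
      linarith [h₁ r k]
  · rw [charMatrix_apply, hY]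
    have h3 := (happ z hz r k).1.trans (min_le_right _ _)
    have h4 := (happ z hz r k).2.trans (min_le_right _ _)
    by_cases h : k = k₀
    · subst h
      rw [Matrix.updateCol_self, ← he_def]
      rw [show ∀ u v w s : ℂ, u + v * e - (w + e * s) = (u - w) + (v - s) * e by intros; ring]
      refine (norm_add_le _ _).trans ?_
      rw [norm_mul]
      have := mul_le_mul h4 he (norm_nonneg _) (by positivity)
      linarith
    · rw [Matrix.updateCol_ne h, add_sub_right_comm]
      refine (norm_add_le _ _).trans ?_
      rw [norm_mul]
      have h5 := mul_le_mul (hdual r k) ((hk k h).trans (min_le_right _ _)) (norm_nonneg _)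
        (by positivity)
      have h6 : (C₂ + 1) * (τ₀ / (4 * (C₂ + 1))) = τ₀ / 4 := by field_simp
      linarith

/-- Away from its zeros, the characteristic determinant is bounded from below. -/
theorem exists_le_norm_det_charMatrix (hab : a < b) (P Q : Fin n → ℂ[X])
    (hθ : (birkhoffMatrix P Q ν).det ≠ 0) {c δ : ℝ} (hc : 0 < c) (hδ : 0 < δ) :
    ∃ η > 0, ∃ R₀ > 0, ∀ z : ℂ, R₀ ≤ ‖z‖ → ∀ k₀, HasDichotomy n ν c z k₀ →
      (∀ w ∈ Metric.closedBall z δ, (charMatrix a b P Q ν w).det ≠ 0) →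
      η ≤ ‖(charMatrix a b P Q ν z).det‖ := by
  set θ := (birkhoffMatrix P Q ν).det with hθ_def
  have hθ0 : 0 < ‖θ‖ := norm_pos_iff.2 hθ
  set L := b - a with hL
  have hL0 : 0 < L := sub_pos.2 hab
  -- On a disc of this radius the argument of the relative change of a tail has modulus at most
  -- `1/2`: tails at most double there, while on the boundary circle the relative change is at least
  -- `r L / 2`.
  set r := min δ (1 / (2 * L)) with hr
  have hr0 : 0 < r := by positivity
  have hrL : r * L ≤ 1 / 2 := by
    calc r * L ≤ 1 / (2 * L) * L := by gcongr; exact min_le_right _ _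
      _ = 1 / 2 := by field_simp
  set ω := ‖θ‖ * (r * L) / 32 with hω
  have hω0 : 0 < ω := by positivity
  obtain ⟨R₁, hR₁, τ, hτ, happ⟩ := exists_det_charMatrix_approx a b P Q ν hω0
  have hexp : Tendsto (fun t : ℝ => 2 * Real.exp (-(c * t * L))) atTop (𝓝 0) := by
    have h1 : Tendsto (fun t : ℝ => c * t * L) atTop atTop :=
      (tendsto_id.const_mul_atTop hc).atTop_mul_const hL0
    simpa using (Real.tendsto_exp_neg_atTop_nhds_zero.comp h1).const_mul 2
  obtain ⟨R₂, hR₂⟩ := eventually_atTop.1 (hexp.eventually (gt_mem_nhds hτ))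
  refine ⟨‖θ‖ * (r * L) / 16, by positivity, max (R₁ + r) (max R₂ (r + 1)), by positivity,
    fun z hz k₀ hdic hne => ?_⟩
  have hz1 : R₁ + r ≤ ‖z‖ := (le_max_left _ _).trans hz
  have hz2 : R₂ ≤ ‖z‖ := ((le_max_left _ _).trans (le_max_right _ _)).trans hz
  have hz3 : r + 1 ≤ ‖z‖ := ((le_max_right _ _).trans (le_max_right _ _)).trans hz
  set f := fun w => (charMatrix a b P Q ν w).det with hf
  set ε := fun w => tailExp a b ν w k₀ with hε
  set θ' := dualDet P Q ν k₀ with hθ'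
  have hwnorm : ∀ w ∈ Metric.closedBall z r, ‖z‖ - r ≤ ‖w‖ := by
    intro w hw
    rw [mem_closedBall_iff_norm] at hw
    have := norm_sub_norm_le z w
    rw [norm_sub_rev] at this
    linarith
  -- The dichotomy is known at the centre only; tails at other points of the disc are compared with
  -- those at `z`.
  have htail : ∀ w ∈ Metric.closedBall z r, ∀ k : Fin n,
      ‖tailExp a b ν w k‖ ≤ ‖tailExp a b ν z k‖ * 2 := by
    intro w hw k
    rw [mem_closedBall_iff_norm] at hw
    rw [tailExp_eq_mul z w, norm_mul]
    gcongr
    refine norm_exp_le_two ?_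
    rw [norm_tailExp_arg hab.le]
    exact le_trans (by gcongr) hrL
  have hfapp : ∀ w ∈ Metric.closedBall z r, ‖f w - (θ + ε w * θ')‖ ≤ ω := by
    intro w hw
    refine happ w (by linarith [hwnorm w hw]) k₀ ?_ fun k hk => ?_
    · have := htail w hw k₀
      have := hdic.norm_tailExp_le_one hab.le k₀
      linarith
    · have h1 := htail w hw k
      have h2 := hdic.norm_tailExp_le hab.le hk
      have h3 := hR₂ ‖z‖ hz2
      linarith
  have hzmem : z ∈ Metric.closedBall z r := Metric.mem_closedBall_self hr0.le
  have hfz := hfapp z hzmem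
  have hθr : ‖θ‖ * (r * L) ≤ ‖θ‖ * (1 / 2) := by gcongr
  rcases le_or_gt ‖ε z * θ'‖ (‖θ‖ / 2) with hcase | hcase
  -- If the neutral term is at most half of `θ`, it cannot cancel `θ`.
  · have h1 : ‖θ‖ ≤ ‖f z‖ + ‖f z - (θ + ε z * θ')‖ + ‖ε z * θ'‖ := by
      calc ‖θ‖ = ‖f z - (f z - (θ + ε z * θ')) - ε z * θ'‖ := by congr 1; ring
        _ ≤ _ := (norm_sub_le _ _).trans (by gcongr; exact norm_sub_le _ _)
    change _ ≤ ‖f z‖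
    linarith
  -- A large neutral term varies a lot between the centre and the circle, so a small `f z` would
  -- make `f` large on the whole circle. The minimum principle then bounds `‖f z‖` below by the same
  -- quantity, giving `2 ‖f z‖ ≥ ‖θ‖ r L / 4 - 2 ω`.
  · have hsph : ∀ w ∈ Metric.sphere z r, ‖θ‖ / 2 * (r * L / 2) - ‖f z‖ - 2 * ω ≤ ‖f w‖ := by
      intro w hw
      have hw' := Metric.sphere_subset_closedBall hw
      rw [mem_sphere_iff_norm] at hw
      have h1 : ε w - ε z = ε z * (tailExp a b ν (w - z) k₀ - 1) := by
        simp only [hε]; rw [tailExp_eq_mul z w]; ring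
      have h2 : r * L / 2 ≤ ‖tailExp a b ν (w - z) k₀ - 1‖ := by
        have h3 := norm_tailExp_arg (n := n) (ν := ν) hab.le (w - z) k₀
        rw [hw] at h3
        have h4 := norm_exp_sub_one_ge (u := exponent n (w - z) k₀ *
          ((farEnd a b ν k₀ : ℂ) - nearEnd a b ν k₀)) (by rw [h3]; exact hrL)
        rwa [h3] at h4
      have h5 : ‖θ‖ / 2 * (r * L / 2) ≤ ‖(ε w - ε z) * θ'‖ := by
        rw [h1, mul_right_comm, norm_mul]
        exact mul_le_mul hcase.le h2 (by positivity) (norm_nonneg _)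
      have h6 : ‖(ε w - ε z) * θ'‖ ≤
          ‖f w‖ + ‖f w - (θ + ε w * θ')‖ + (‖f z‖ + ‖f z - (θ + ε z * θ')‖) := by
        calc ‖(ε w - ε z) * θ'‖
            = ‖(f w - (f w - (θ + ε w * θ'))) - (f z - (f z - (θ + ε z * θ')))‖ := by
              congr 1; ring
          _ ≤ _ := (norm_sub_le _ _).trans (add_le_add (norm_sub_le _ _) (norm_sub_le _ _))
      linarith [hfapp w hw']
    change _ ≤ ‖f z‖
    rcases le_or_gt (‖θ‖ / 2 * (r * L / 2) - ‖f z‖ - 2 * ω) 0 with hm | hm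
    · linarith
    · have hcl : closure (Metric.ball z r) = Metric.closedBall z r := closure_ball z hr0.ne'
      have hdiff : DifferentiableOn ℂ f (closure (Metric.ball z r)) := by
        intro w hw
        rw [hcl] at hw
        have hw0 : w ≠ 0 := by
          rw [← norm_pos_iff]; linarith [hwnorm w hw]
        exact (differentiableAt_det_charMatrix hw0).differentiableWithinAt
      have h1 := le_norm_center_of_le_norm_sphere hr0 hm hdiff.diffContOnCl
        (fun w hw => hne w (Metric.closedBall_subset_closedBall (min_le_left _ _) hw)) hsph
      linarith

lemma exists_charMatrix_entry_bound (hab : a ≤ b) (P Q : Fin n → ℂ[X]) (ν : ℕ) :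
    ∃ C > 0, ∃ R₀ > 0, ∀ z : ℂ, R₀ ≤ ‖z‖ → ∀ c k₀, HasDichotomy n ν c z k₀ → ∀ r k : Fin n,
      ‖charMatrix a b P Q ν z r k‖ ≤ C ∧
      ‖(if (k : ℕ) < ν then Q r else P r).eval (exponent n z k) /
        (Complex.I * z) ^ bcOrder (P r) (Q r)‖ ≤ C := by
  obtain ⟨C₁, hC₁, h₁⟩ := exists_entry_bound (birkhoffMatrix P Q ν)
  obtain ⟨C₂, hC₂, h₂⟩ := exists_entry_bound (dualBirkhoffMatrix P Q ν)
  obtain ⟨R₀, hR₀, happ⟩ := exists_charMatrix_parts_approx P Q ν one_pos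
  refine ⟨C₁ + 1 + (C₂ + 1), by positivity, R₀, hR₀, fun z hz c k₀ hdic r k => ?_⟩
  have hmain := norm_le_norm_add_norm_sub'
    ((if (k : ℕ) < ν then P r else Q r).eval (exponent n z k) /
        (Complex.I * z) ^ bcOrder (P r) (Q r)) (birkhoffMatrix P Q ν r k)
  have hdual := norm_le_norm_add_norm_sub'
    ((if (k : ℕ) < ν then Q r else P r).eval (exponent n z k) /
        (Complex.I * z) ^ bcOrder (P r) (Q r)) (dualBirkhoffMatrix P Q ν r k)
  have h3 := happ z hz r k
  have h4 := h₁ r k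
  have h5 := h₂ r k
  constructor
  · rw [charMatrix_apply]
    refine (norm_add_le _ _).trans ?_
    rw [norm_mul]
    have h6 := mul_le_mul_of_nonneg_left (hdic.norm_tailExp_le_one hab k)
      (norm_nonneg ((if (k : ℕ) < ν then Q r else P r).eval (exponent n z k) /
        (Complex.I * z) ^ bcOrder (P r) (Q r)))
    linarith
  · linarith

end TraceFormula

namespace TraceFormula

/-! ### The sector `0 ≤ arg z ≤ 2π/n` -/

section Sector

variable {n : ℕ}

lemma exponent_re (R φ : ℝ) (k : Fin n) :
    (exponent n (R * Complex.exp (φ * Complex.I)) k).re =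
      -(R * Real.sin (φ + 2 * Real.pi / n * k)) := by
  have h : exponent n (R * Complex.exp (φ * Complex.I)) k =
      Complex.I * (R * Complex.exp (((φ + 2 * Real.pi / n * k : ℝ) : ℂ) * Complex.I)) := by
    rw [exponent, unityRoot, ← Complex.exp_nat_mul, mul_assoc, mul_assoc, ← Complex.exp_add]
    congr 3
    push_cast
    ring
  rw [h, Complex.I_mul_re, Complex.im_ofReal_mul, Complex.exp_ofReal_mul_I_im]

lemma sin_le_sin_of_mem {h θ : ℝ} (hh : 0 ≤ h) (h1 : h ≤ θ) (h2 : θ ≤ Real.pi - h) :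
    Real.sin h ≤ Real.sin θ := by
  rcases le_total θ (Real.pi / 2) with h3 | h3
  · exact Real.sin_le_sin_of_le_of_le_pi_div_two (by linarith [Real.pi_pos]) h3 h1
  · rw [← Real.sin_pi_sub θ]
    exact Real.sin_le_sin_of_le_of_le_pi_div_two (by linarith [Real.pi_pos]) (by linarith)
      (by linarith)

lemma hasDichotomy_of_angles {ν : ℕ} {R φ h : ℝ} (hR : 0 ≤ R) (hh : 0 ≤ h) (hh' : h ≤ Real.pi / 2)
    {k₀ : Fin n}
    (h1 : ∀ k : Fin n, (k : ℕ) < ν →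
      0 ≤ φ + 2 * Real.pi / n * k ∧ φ + 2 * Real.pi / n * k ≤ Real.pi)
    (h2 : ∀ k : Fin n, ν ≤ (k : ℕ) →
      Real.pi ≤ φ + 2 * Real.pi / n * k ∧ φ + 2 * Real.pi / n * k ≤ 2 * Real.pi)
    (h3 : ∀ k : Fin n, k ≠ k₀ → (k : ℕ) < ν →
      h ≤ φ + 2 * Real.pi / n * k ∧ φ + 2 * Real.pi / n * k ≤ Real.pi - h)
    (h4 : ∀ k : Fin n, k ≠ k₀ → ν ≤ (k : ℕ) →
      Real.pi + h ≤ φ + 2 * Real.pi / n * k ∧ φ + 2 * Real.pi / n * k ≤ 2 * Real.pi - h) :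
    HasDichotomy n ν (Real.sin h) (R * Complex.exp (φ * Complex.I)) k₀ where
  re_nonpos k hk := by
    rw [exponent_re, neg_nonpos]
    exact mul_nonneg hR (Real.sin_nonneg_of_nonneg_of_le_pi (h1 k hk).1 (h1 k hk).2)
  re_nonneg k hk := by
    have h5 : Real.sin (φ + 2 * Real.pi / n * k) ≤ 0 := by
      rw [← neg_nonneg, ← Real.sin_sub_pi]
      exact Real.sin_nonneg_of_nonneg_of_le_pi (by linarith [(h2 k hk).1])
        (by linarith [(h2 k hk).2])
    rw [exponent_re, ← mul_neg]
    exact mul_nonneg hR (neg_nonneg.2 h5)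
  gap k hk := by
    have hs : 0 ≤ Real.sin h := Real.sin_nonneg_of_nonneg_of_le_pi hh (by linarith [Real.pi_pos])
    rw [exponent_re, abs_neg, abs_mul, abs_of_nonneg hR, norm_mul, Complex.norm_exp_ofReal_mul_I,
      Complex.norm_real, Real.norm_eq_abs, abs_of_nonneg hR, mul_one, mul_comm]
    refine mul_le_mul_of_nonneg_left ?_ hR
    rcases lt_or_ge (k : ℕ) ν with hν | hν
    · exact (sin_le_sin_of_mem hh (h3 k hk hν).1 (h3 k hk hν).2).trans (le_abs_self _)
    · have h5 := sin_le_sin_of_mem hh (θ := φ + 2 * Real.pi / n * k - Real.pi)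
        (by linarith [(h4 k hk hν).1]) (by linarith [(h4 k hk hν).2])
      rw [Real.sin_sub_pi] at h5
      exact h5.trans (neg_le_abs _)

/-- With `n = 2 m + 1` and `h = π / (2 n)`, the point `z ρ ^ k` has angle `φ + 4 h k`, and `π = 4 h
m + 2 h`. Hence an angle can be a multiple of `π` only for `φ = 0` (`k = 0`), `φ = 2 h` (`k = m`) or
`φ = 4 h` (`k = 2 m`). Cutting `[0, 4 h]` at `h` and `3 h` leaves one candidate `k₀` per piece, all
other angles being at least `h` from multiples of `π`. As `φ` passes `2 h` the `m`-th angle crosses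
`π`, and `ν` drops from `m + 1` to `m`. -/
theorem exists_hasDichotomy (hn : 3 ≤ n) (hodd : Odd n) {R φ : ℝ} (hR : 0 ≤ R)
    (hφ : φ ∈ Icc 0 (2 * Real.pi / n)) :
    ∃ ν, (ν = (n + 1) / 2 ∨ ν = n / 2) ∧ ∃ k₀ : Fin n,
      HasDichotomy n ν (Real.sin (Real.pi / (2 * n))) (R * Complex.exp (φ * Complex.I)) k₀ := by
  obtain ⟨m, rfl⟩ := hodd
  set h := Real.pi / (2 * (2 * m + 1 : ℕ)) with hh
  have hN : (0 : ℝ) < (2 * m + 1 : ℕ) := by positivity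
  have hh0 : 0 < h := by have := Real.pi_pos; positivity
  have hπ : Real.pi = 4 * (h * m) + 2 * h := by
    rw [hh]; field_simp; push_cast; ring
  have h4 : 2 * Real.pi / (2 * m + 1 : ℕ) = 4 * h := by
    rw [hh]; field_simp; norm_num
  have hm1 : 1 ≤ m := by omega
  have hm : h ≤ h * m := le_mul_of_one_le_right hh0.le (by exact_mod_cast hm1)
  have up : ∀ (k : Fin (2 * m + 1)) (i j : ℕ), (k : ℕ) + i ≤ j → h * k + h * i ≤ h * j := by
    intro k i j hk
    rw [← mul_add]
    exact mul_le_mul_of_nonneg_left (by exact_mod_cast hk) hh0.le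
  have lo : ∀ (k : Fin (2 * m + 1)) (j : ℕ), j ≤ (k : ℕ) → h * j ≤ h * k := by
    intro k j hk
    exact mul_le_mul_of_nonneg_left (by exact_mod_cast hk) hh0.le
  have hnn : ∀ k : Fin (2 * m + 1), 0 ≤ h * k := fun k => by positivity
  have htop : ∀ k : Fin (2 * m + 1), h * k ≤ 2 * (h * m) := by
    intro k
    have := up k 0 (2 * m) (by omega)
    push_cast at this
    linarith
  rw [h4] at hφ
  obtain ⟨hφ0, hφ4⟩ := hφ
  have hπ2 : h ≤ Real.pi / 2 := by linarith
  have e1 : (2 * m + 1 + 1) / 2 = m + 1 := by omega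
  have e2 : (2 * m + 1) / 2 = m := by omega
  rw [e1, e2]
  rcases le_total φ (2 * h) with hc | hc
  · refine ⟨m + 1, Or.inl rfl, ?_⟩
    have hlt : ∀ k : Fin (2 * m + 1), (k : ℕ) < m + 1 → h * k ≤ h * m := fun k hk => by
      simpa using up k 0 m (by omega)
    have hge : ∀ k : Fin (2 * m + 1), m + 1 ≤ (k : ℕ) → h * m + h ≤ h * k := fun k hk => by
      have := lo k (m + 1) hk
      push_cast at this
      linarith
    rcases le_total φ h with hd | hd
    · refine ⟨⟨0, by omega⟩, hasDichotomy_of_angles hR hh0.le hπ2 ?_ ?_ ?_ ?_⟩ <;> rw [h4]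
      · intro k hk
        have := hlt k hk; have := hnn k
        constructor <;> linarith
      · intro k hk
        have := hge k hk; have := htop k
        constructor <;> linarith
      · intro k hne hk
        have h1 := lo k 1 (Nat.one_le_iff_ne_zero.2 fun h0 => hne (Fin.ext h0))
        have := hlt k hk
        push_cast at h1
        constructor <;> linarith
      · intro k _ hk
        have := hge k hk; have := htop k
        constructor <;> linarith
    · refine ⟨⟨m, by omega⟩, hasDichotomy_of_angles hR hh0.le hπ2 ?_ ?_ ?_ ?_⟩ <;> rw [h4]
      · intro k hk
        have := hlt k hk; have := hnn k
        constructor <;> linarith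
      · intro k hk
        have := hge k hk; have := htop k
        constructor <;> linarith
      · intro k hne hk
        have h1 := up k 1 m (by
          have : (k : ℕ) ≠ m := fun h0 => hne (Fin.ext h0)
          omega)
        have := hnn k
        push_cast at h1
        constructor <;> linarith
      · intro k _ hk
        have := hge k hk; have := htop k
        constructor <;> linarith
  · refine ⟨m, Or.inr rfl, ?_⟩
    have hlt : ∀ k : Fin (2 * m + 1), (k : ℕ) < m → h * k + h ≤ h * m := fun k hk => by
      simpa using up k 1 m (by omega)
    have hge : ∀ k : Fin (2 * m + 1), m ≤ (k : ℕ) → h * m ≤ h * k := fun k hk => lo k m hk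
    rcases le_total φ (3 * h) with hd | hd
    · refine ⟨⟨m, by omega⟩, hasDichotomy_of_angles hR hh0.le hπ2 ?_ ?_ ?_ ?_⟩ <;> rw [h4]
      · intro k hk
        have := hlt k hk; have := hnn k
        constructor <;> linarith
      · intro k hk
        have := hge k hk; have := htop k
        constructor <;> linarith
      · intro k _ hk
        have := hlt k hk; have := hnn k
        constructor <;> linarith
      · intro k hne hk
        have h1 := lo k (m + 1) (by
          have : (k : ℕ) ≠ m := fun h0 => hne (Fin.ext h0)
          omega)
        have := htop k
        push_cast at h1
        constructor <;> linarith
    · refine ⟨⟨2 * m, by omega⟩, hasDichotomy_of_angles hR hh0.le hπ2 ?_ ?_ ?_ ?_⟩ <;> rw [h4]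
      · intro k hk
        have := hlt k hk; have := hnn k
        constructor <;> linarith
      · intro k hk
        have := hge k hk; have := htop k
        constructor <;> linarith
      · intro k _ hk
        have := hlt k hk; have := hnn k
        constructor <;> linarith
      · intro k hne hk
        have h1 := up k 1 (2 * m) (by
          have : (k : ℕ) ≠ 2 * m := fun h0 => hne (Fin.ext h0)
          omega)
        have := hge k hk
        push_cast at h1
        constructor <;> linarith

end Sector

/-! ### Separation of the contours from the rotated spectrum -/

section Separation

/-- Jordan's inequality `2 |α| / π ≤ |sin α|`, applied with `|sin (arg u)| = |im u| / |u| ≤ 2 t`. -/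
lemma abs_arg_le_of_norm_sub_one_le {u : ℂ} {t : ℝ} (ht : t < 1 / 2) (hu : ‖u - 1‖ ≤ t) :
    |u.arg| ≤ Real.pi * t := by
  have hre : 1 / 2 < u.re := by
    have h1 := Complex.abs_re_le_norm (u - 1)
    rw [Complex.sub_re, Complex.one_re] at h1
    have := (abs_le.1 (h1.trans hu)).1
    linarith
  have hnorm : 1 / 2 < ‖u‖ := hre.trans_le (Complex.re_le_norm u)
  have him : |u.im| ≤ t := by
    have h1 := Complex.abs_im_le_norm (u - 1)
    rw [Complex.sub_im, Complex.one_im, sub_zero] at h1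
    exact h1.trans hu
  have hlt : |u.arg| < Real.pi / 2 :=
    Complex.abs_arg_lt_pi_div_two_iff.2 (Or.inl (by linarith))
  have hsin : |Real.sin u.arg| ≤ 2 * t := by
    rw [Complex.sin_arg, abs_div, abs_norm, div_le_iff₀ (by linarith)]
    have : 0 ≤ t := (norm_nonneg _).trans hu
    nlinarith
  have h2 : 2 / Real.pi * |u.arg| ≤ |Real.sin u.arg| := by
    have h3 := Real.mul_le_sin (abs_nonneg u.arg) hlt.le
    refine h3.trans ?_
    rcases abs_cases u.arg with h | h
    · rw [h.1]; exact le_abs_self _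
    · rw [h.1, Real.sin_neg]; exact neg_le_abs _
  have h3 : 2 / Real.pi * |u.arg| ≤ 2 * t := h2.trans hsin
  have hπ := Real.pi_pos
  rw [div_mul_eq_mul_div, div_le_iff₀ hπ] at h3
  linarith

lemma norm_exp_mul_I_sub_le (x y : ℝ) :
    ‖Complex.exp (x * Complex.I) - Complex.exp (y * Complex.I)‖ ≤ |x - y| := by
  have h1 : Complex.exp (x * Complex.I) - Complex.exp (y * Complex.I) =
      Complex.exp (y * Complex.I) * (Complex.exp (Complex.I * ((x - y : ℝ) : ℂ)) - 1) := by
    rw [mul_sub, ← Complex.exp_add, mul_one]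
    congr 2
    push_cast
    ring
  rw [h1, norm_mul, Complex.norm_exp_ofReal_mul_I, one_mul]
  exact Real.norm_exp_I_mul_ofReal_sub_one_le

variable {n : ℕ} {S : Set ℂ} {R : ℕ → ℝ → ℝ}

lemma exp_mul_I_pow_eq (hn : n ≠ 0) (s ψ : ℝ) :
    ((s : ℂ) * Complex.exp (((ψ + 2 * Real.pi / n : ℝ) : ℂ) * Complex.I)) ^ n =
      ((s : ℂ) * Complex.exp ((ψ : ℂ) * Complex.I)) ^ n := by
  have h1 : Complex.exp (((ψ + 2 * Real.pi / n : ℝ) : ℂ) * Complex.I) =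
      Complex.exp ((ψ : ℂ) * Complex.I) * unityRoot n := by
    rw [unityRoot, ← Complex.exp_add]
    congr 1
    push_cast
    ring
  rw [h1, ← mul_assoc, mul_pow, (unityRoot_isPrimitiveRoot hn).pow_eq_one, mul_one]

/-- For an acceptable sequence the contours stay away from all the `n`-th roots of the elements of
`S`, not only from those in the sector. -/
theorem IsAcceptable.exists_separation (hn : 3 ≤ n) (hR : IsAcceptable n S R) :
    ∃ δ' > 0, ∀ᶠ ℓ in atTop, ∀ φ ∈ Icc 0 (2 * Real.pi / n), ∀ w : ℂ, w ^ n ∈ S →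
      δ' < ‖w - (R ℓ φ : ℂ) * Complex.exp (φ * Complex.I)‖ := by
  obtain ⟨c₁, hc₁, hosc⟩ := hR.oscillation
  obtain ⟨c₂, hc₂, hslope⟩ := hR.slope
  obtain ⟨δ, hδ, hsep⟩ := hR.separated
  have hπ := Real.pi_pos
  have hn0 : (0 : ℝ) < n := by exact_mod_cast (by omega : 0 < n)
  have hper : 2 * Real.pi / n < Real.pi := by
    rw [div_lt_iff₀ hn0]
    have : (3 : ℝ) ≤ n := by exact_mod_cast hn
    nlinarith
  have hper0 : 0 < 2 * Real.pi / n := by positivity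
  -- A root within `δ'` of the contour but outside the sector turns out to be within `δ' K` of an
  -- end point of the curve: `δ'` for the initial distance, `π δ'` for the turn in angle, `2 π c₂
  -- δ'` for the change of radius.
  set K := 1 + Real.pi + 2 * Real.pi * c₂ with hK
  have hK1 : 1 ≤ K := by
    have : 0 ≤ 2 * Real.pi * c₂ := by positivity
    linarith
  set δ' := δ / (2 * K) with hδ'
  have hδ'0 : 0 < δ' := by positivity
  have hKδ : δ' * K < δ := by
    have : δ' * K = δ / 2 := by rw [hδ']; field_simp
    linarith
  have hδδ : δ' < δ := lt_of_le_of_lt (le_mul_of_one_le_right hδ'0.le hK1) hKδ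
  refine ⟨δ', hδ'0, ?_⟩
  -- The three terms yield in turn `R ≤ 2 r` along the arc, `δ' / r < 1/2`, and an angular deviation
  -- `|β| < 2π/n`, so that one rotation brings the root back into the sector.
  filter_upwards [hR.tendsto.eventually_ge_atTop (4 * c₁ + 3 * δ' + n * δ')] with ℓ hℓ φ hφ w hw
  by_contra! hcon
  set r := R ℓ φ with hr
  have hr0 : 0 < r := hR.pos ℓ φ hφ
  have hbd := fun ψ hψ => abs_le.1 (hosc ℓ ψ hψ)
  have hnδ : 0 < n * δ' := by positivity
  have hrR : R ℓ 0 - c₁ ≤ r := by linarith [(hbd φ hφ).1]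
  have hmax : ∀ ψ ∈ Icc 0 (2 * Real.pi / n), R ℓ ψ ≤ 2 * r := fun ψ hψ => by
    linarith [(hbd ψ hψ).2]
  set z := (r : ℂ) * Complex.exp (φ * Complex.I) with hz
  have hznorm : ‖z‖ = r := by
    rw [hz, norm_mul, Complex.norm_exp_ofReal_mul_I, mul_one, Complex.norm_real,
      Real.norm_eq_abs, abs_of_pos hr0]
  have hz0 : z ≠ 0 := norm_pos_iff.1 (by rw [hznorm]; exact hr0)
  set u := w / z with hu
  have hwu : w = z * u := by rw [hu, mul_div_cancel₀ _ hz0]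
  have hu1 : ‖u - 1‖ ≤ δ' / r := by
    rw [hu, div_sub_one hz0, norm_div, hznorm]
    gcongr
  have ht : δ' / r < 1 / 2 := by
    rw [div_lt_iff₀ hr0]; linarith
  set β := u.arg with hβ
  have hβ1 : |β| ≤ Real.pi * (δ' / r) := abs_arg_le_of_norm_sub_one_le ht hu1
  have hβ2 : |β| < 2 * Real.pi / n := by
    refine hβ1.trans_lt ?_
    rw [mul_div_assoc', div_lt_div_iff₀ hr0 hn0]
    nlinarith
  have hu0 : u ≠ 0 := by
    rintro h0
    rw [h0, zero_sub, norm_neg, norm_one] at hu1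
    linarith
  set s := r * ‖u‖ with hs
  have hs0 : 0 < s := mul_pos hr0 (norm_pos_iff.2 hu0)
  have hws : w = (s : ℂ) * Complex.exp (((φ + β : ℝ) : ℂ) * Complex.I) := by
    rw [hwu, hz, hs]
    conv_lhs => rw [← Complex.norm_mul_exp_arg_mul_I u]
    rw [show (((φ + β : ℝ) : ℂ) * Complex.I) = φ * Complex.I + β * Complex.I by push_cast; ring,
      Complex.exp_add]
    push_cast
    ring
  have hroot : ∀ ψ ∈ Ico 0 (2 * Real.pi / n),
      ((s : ℂ) * Complex.exp ((ψ : ℂ) * Complex.I)) ^ n ∈ S →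
      (s : ℂ) * Complex.exp ((ψ : ℂ) * Complex.I) ∈ sectorRoots n S := by
    intro ψ hψ hmem
    have harg : ((s : ℂ) * Complex.exp ((ψ : ℂ) * Complex.I)).arg = ψ := by
      rw [Complex.exp_mul_I]
      exact Complex.arg_mul_cos_add_sin_mul_I hs0 ⟨by linarith [hψ.1], by linarith [hψ.2]⟩
    exact ⟨hmem, by rw [harg]; exact hψ.1, by rw [harg]; exact hψ.2⟩
  have hclose : ∀ θ ∈ Icc 0 (2 * Real.pi / n), R ℓ θ = R ℓ 0 → |θ - φ| ≤ |β| →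
      ‖(R ℓ 0 : ℂ) * Complex.exp (θ * Complex.I) - w‖ < δ := by
    intro θ hθ hθ0 hθβ
    have h1 : |R ℓ θ - r| ≤ c₂ * (2 * r) * |θ - φ| := by
      have := (convex_Icc 0 (2 * Real.pi / n)).norm_image_sub_le_of_norm_derivWithin_le
        (f := R ℓ) (C := c₂ * (2 * r)) ((hR.smooth ℓ).differentiableOn (by simp))
        (fun x hx => (hslope ℓ x hx).trans (by gcongr; exact hmax x hx)) hφ hθ
      simpa [Real.norm_eq_abs] using this
    have h2 : |θ - φ| * r ≤ Real.pi * δ' := by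
      calc |θ - φ| * r ≤ Real.pi * (δ' / r) * r := by gcongr; exact hθβ.trans hβ1
        _ = Real.pi * δ' := by field_simp
    have h3 : (R ℓ 0 : ℂ) * Complex.exp (θ * Complex.I) - w =
        ((R ℓ θ - r : ℝ) : ℂ) * Complex.exp (θ * Complex.I) +
        (r : ℂ) * (Complex.exp (θ * Complex.I) - Complex.exp (φ * Complex.I)) - (w - z) := by
      rw [hz, ← hθ0]; push_cast; ring
    rw [h3]
    calc _ ≤ ‖((R ℓ θ - r : ℝ) : ℂ) * Complex.exp (θ * Complex.I)‖ +
        ‖(r : ℂ) * (Complex.exp (θ * Complex.I) - Complex.exp (φ * Complex.I))‖ + ‖w - z‖ :=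
          (norm_sub_le _ _).trans (by gcongr; exact norm_add_le _ _)
      _ ≤ c₂ * (2 * r) * |θ - φ| + r * |θ - φ| + δ' := by
        refine add_le_add (add_le_add ?_ ?_) hcon
        · rw [norm_mul, Complex.norm_exp_ofReal_mul_I, mul_one, Complex.norm_real]
          exact h1
        · rw [norm_mul, Complex.norm_real, Real.norm_eq_abs, abs_of_pos hr0]
          gcongr
          exact norm_exp_mul_I_sub_le θ φ
      _ = (2 * c₂ + 1) * (|θ - φ| * r) + δ' := by ring
      _ ≤ (2 * c₂ + 1) * (Real.pi * δ') + δ' := by gcongr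
      _ = δ' * K := by rw [hK]; ring
      _ < δ := hKδ
  have hβ' := abs_lt.1 hβ2
  have hn' : n ≠ 0 := by omega
  -- A root that left the sector at one side is rotated by `2π/n` to the other side. As `R` takes
  -- equal values at the ends, the rotation also carries one end of the curve to the other, so
  -- closeness contradicts separation there.
  rcases lt_or_ge (φ + β) 0 with hneg | hnonneg
  · have hmem := hroot (φ + β + 2 * Real.pi / n) ⟨by linarith [hφ.1], by linarith⟩ (by
      rw [exp_mul_I_pow_eq hn', ← hws]; exact hw)
    have h1 := hsep ℓ (2 * Real.pi / n) (right_mem_Icc.2 hper0.le) _ hmem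
    have h2 := hclose 0 (left_mem_Icc.2 hper0.le) rfl (by
      rw [zero_sub, abs_neg, abs_of_nonneg hφ.1]
      exact le_trans (by linarith) (neg_le_abs β))
    have h3 : (R ℓ (2 * Real.pi / n) : ℂ) * Complex.exp ((2 * Real.pi / n : ℝ) * Complex.I) -
        (s : ℂ) * Complex.exp (((φ + β + 2 * Real.pi / n : ℝ) : ℂ) * Complex.I) =
        ((R ℓ 0 : ℂ) * Complex.exp ((0 : ℝ) * Complex.I) - w) *
          Complex.exp ((2 * Real.pi / n : ℝ) * Complex.I) := by
      have h4 : (((φ + β + 2 * Real.pi / n : ℝ) : ℂ) * Complex.I) =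
          ((φ + β : ℝ) : ℂ) * Complex.I + ((2 * Real.pi / n : ℝ) : ℂ) * Complex.I := by
        push_cast; ring
      rw [hR.closed, hws, h4, Complex.exp_add, Complex.ofReal_zero, zero_mul, Complex.exp_zero]
      ring
    rw [dist_eq_norm, h3, norm_mul, Complex.norm_exp_ofReal_mul_I, mul_one] at h1
    linarith
  · rcases lt_or_ge (φ + β) (2 * Real.pi / n) with hlt | hge
    · have hmem := hroot (φ + β) ⟨hnonneg, hlt⟩ (by rw [← hws]; exact hw)
      have h1 := hsep ℓ φ hφ _ hmem
      rw [← hws, dist_eq_norm, norm_sub_rev] at h1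
      linarith
    · have hmem := hroot (φ + β - 2 * Real.pi / n) ⟨by linarith, by linarith [hφ.2]⟩ (by
        rw [← exp_mul_I_pow_eq hn', sub_add_cancel, ← hws]; exact hw)
      have h1 := hsep ℓ 0 (left_mem_Icc.2 hper0.le) _ hmem
      have h2 := hclose (2 * Real.pi / n) (right_mem_Icc.2 hper0.le) (hR.closed ℓ) (by
        rw [abs_of_nonneg (by linarith [hφ.2])]
        exact le_trans (by linarith) (le_abs_self β))
      have h3 : (R ℓ 0 : ℂ) * Complex.exp ((2 * Real.pi / n : ℝ) * Complex.I) - w =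
          ((R ℓ 0 : ℂ) * Complex.exp ((0 : ℝ) * Complex.I) -
            (s : ℂ) * Complex.exp (((φ + β - 2 * Real.pi / n : ℝ) : ℂ) * Complex.I)) *
            Complex.exp ((2 * Real.pi / n : ℝ) * Complex.I) := by
        have h4 : ((φ + β : ℝ) : ℂ) * Complex.I =
            ((φ + β - 2 * Real.pi / n : ℝ) : ℂ) * Complex.I +
              ((2 * Real.pi / n : ℝ) : ℂ) * Complex.I := by
          push_cast; ring
        rw [hws, h4, Complex.exp_add, Complex.ofReal_zero, zero_mul, Complex.exp_zero]
        ring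
      rw [h3, norm_mul, Complex.norm_exp_ofReal_mul_I, mul_one] at h2
      rw [dist_eq_norm] at h1
      linarith

end Separation

end TraceFormula

namespace TraceFormula

/-! ### The Green function on the diagonal -/

section Diagonal

variable {n : ℕ} {a b : ℝ} {P Q : Fin n → ℂ[X]} {ν : ℕ} {z : ℂ}

lemma sum_mul_expForm_eq (hz : z ≠ 0) (v : Fin n → ℂ) (r : Fin n) :
    ∑ j, (v j * Complex.exp (-(exponent n z j * nearEnd a b ν j))) *
        expForm a b (P r) (Q r) (exponent n z j) =
      (charMatrix a b P Q ν z).mulVec v r * (Complex.I * z) ^ bcOrder (P r) (Q r) := by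
  have hne : (Complex.I * z) ^ bcOrder (P r) (Q r) ≠ 0 :=
    pow_ne_zero _ (mul_ne_zero Complex.I_ne_zero hz)
  simp only [Matrix.mulVec, dotProduct, Finset.sum_mul]
  refine Finset.sum_congr rfl fun j _ => ?_
  rw [charMatrix_apply_eq_expForm]
  field_simp

lemma mem_eigenvalues_of_det_charMatrix_eq_zero (hab : a < b) (hz : z ≠ 0)
    (hP : ∀ j, (P j).natDegree < n) (hQ : ∀ j, (Q j).natDegree < n)
    (hdet : (charMatrix a b P Q ν z).det = 0) : z ^ n ∈ eigenvalues n a b 0 P Q := by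
  obtain ⟨v, hv, hv0⟩ := Matrix.exists_mulVec_eq_zero_iff.2 hdet
  refine mem_eigenvalues_of_expForm (v := fun j => v j *
    Complex.exp (-(exponent n z j * nearEnd a b ν j))) hab hz hP hQ ?_ fun r => ?_
  · intro h
    refine hv (funext fun j => ?_)
    exact (mul_eq_zero.1 (congrFun h j)).resolve_right (Complex.exp_ne_zero _)
  · rw [sum_mul_expForm_eq hz, hv0, Pi.zero_apply, zero_mul]

lemma eq_zero_of_det_charMatrix_ne_zero (hz : z ≠ 0) (hdet : (charMatrix a b P Q ν z).det ≠ 0)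
    (v : Fin n → ℂ) (h : ∀ r, ∑ j, v j * expForm a b (P r) (Q r) (exponent n z j) = 0) :
    v = 0 := by
  have h0 : (fun j => v j * Complex.exp (exponent n z j * nearEnd a b ν j)) = 0 := by
    refine Matrix.eq_zero_of_mulVec_eq_zero hdet (funext fun r => ?_)
    have h1 := sum_mul_expForm_eq (a := a) (b := b) (P := P) (Q := Q) (ν := ν) hz
      (fun j => v j * Complex.exp (exponent n z j * nearEnd a b ν j)) r
    simp only [mul_assoc (v _), ← Complex.exp_add, add_neg_cancel, Complex.exp_zero,
      mul_one] at h1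
    rw [h r] at h1
    exact (mul_eq_zero.1 h1.symm).resolve_right
      (pow_ne_zero _ (mul_ne_zero Complex.I_ne_zero hz))
  funext j
  exact (mul_eq_zero.1 (congrFun h0 j)).resolve_right (Complex.exp_ne_zero _)

/-- The boundary forms of the exponentials with values prescribed at `farEnd`, as produced by the
free fundamental solution. -/
noncomputable def sourceMatrix (P Q : Fin n → ℂ[X]) (ν : ℕ) (z : ℂ) :
    Matrix (Fin n) (Fin n) ℂ :=
  Matrix.of fun r k => (if (k : ℕ) < ν then 1 else -1) *
    ((if (k : ℕ) < ν then Q r else P r).eval (exponent n z k) /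
      (Complex.I * z) ^ bcOrder (P r) (Q r))

/-- The coefficients in the expansion of the Green function in products of exponentials. -/
noncomputable def greenCoeff (a b : ℝ) (P Q : Fin n → ℂ[X]) (ν : ℕ) (z : ℂ) :
    Matrix (Fin n) (Fin n) ℂ :=
  -((charMatrix a b P Q ν z)⁻¹ * sourceMatrix P Q ν z)

lemma charMatrix_mul_greenCoeff (hdet : (charMatrix a b P Q ν z).det ≠ 0) :
    charMatrix a b P Q ν z * greenCoeff a b P Q ν z = -sourceMatrix P Q ν z := by
  rw [greenCoeff, mul_neg, Matrix.mul_nonsing_inv_cancel_left _ _ (isUnit_iff_ne_zero.2 hdet)]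

/-- The coefficients of the exponentials in the regular part of the Green function. -/
noncomputable def regularCoeff (a b : ℝ) (P Q : Fin n → ℂ[X]) (ν : ℕ) (z : ℂ) (j : Fin n)
    (ξ : ℝ) : ℂ :=
  (if (j : ℕ) < ν then 0 else -(fundCoeff n z j * Complex.exp (-(exponent n z j * ξ)))) +
    (∑ k, greenCoeff a b P Q ν z j k *
      (fundCoeff n z k * Complex.exp (exponent n z k * (farEnd a b ν k - ξ)))) *
      Complex.exp (-(exponent n z j * nearEnd a b ν j))

lemma continuous_regularCoeff (j : Fin n) : Continuous (regularCoeff a b P Q ν z j) := by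
  unfold regularCoeff
  split_ifs <;> fun_prop

/-- Subtracting the exponentials with `k ≥ ν` turns the causal solution into one that uses only `k <
ν` to the right of `ξ` and only `k ≥ ν`, with opposite sign, to the left. It reaches the boundary
through `Q` at `b` and `-P` at `a`, that is, at `farEnd`: the source matrix. `greenCoeff` is chosen
to cancel this. -/
lemma boundary_regularCoeff (hz : z ≠ 0) (hdet : (charMatrix a b P Q ν z).det ≠ 0) (ξ : ℝ)
    (r : Fin n) :
    ∑ j, (regularCoeff a b P Q ν z j ξ * expForm a b (P r) (Q r) (exponent n z j) +
      fundCoeff n z j * Complex.exp (exponent n z j * (b - ξ)) *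
        (Q r).eval (exponent n z j)) = 0 := by
  have hne : (Complex.I * z) ^ bcOrder (P r) (Q r) ≠ 0 :=
    pow_ne_zero _ (mul_ne_zero Complex.I_ne_zero hz)
  set s : Fin n → ℂ := fun k =>
    fundCoeff n z k * Complex.exp (exponent n z k * (farEnd a b ν k - ξ)) with hs
  have h1 : ∀ j, regularCoeff a b P Q ν z j ξ * expForm a b (P r) (Q r) (exponent n z j) +
      fundCoeff n z j * Complex.exp (exponent n z j * (b - ξ)) * (Q r).eval (exponent n z j) =
      ((greenCoeff a b P Q ν z).mulVec s j *
          Complex.exp (-(exponent n z j * nearEnd a b ν j))) *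
        expForm a b (P r) (Q r) (exponent n z j) +
      sourceMatrix P Q ν z r j * s j * (Complex.I * z) ^ bcOrder (P r) (Q r) := by
    intro j
    have h2 : ∀ c : ℝ, Complex.exp (exponent n z j * (c - ξ)) =
        Complex.exp (-(exponent n z j * ξ)) * Complex.exp (exponent n z j * c) := by
      intro c; rw [← Complex.exp_add]; ring_nf
    have h3 : regularCoeff a b P Q ν z j ξ =
        (if (j : ℕ) < ν then 0 else -(fundCoeff n z j * Complex.exp (-(exponent n z j * ξ)))) +
        (greenCoeff a b P Q ν z).mulVec s j *
          Complex.exp (-(exponent n z j * nearEnd a b ν j)) := rfl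
    rw [h3]
    generalize (greenCoeff a b P Q ν z).mulVec s j *
          Complex.exp (-(exponent n z j * nearEnd a b ν j)) = t
    simp only [hs, sourceMatrix, Matrix.of_apply, farEnd]
    split_ifs with hj
    · field_simp
      ring
    · rw [h2, h2, expForm]
      field_simp
      ring
  rw [Finset.sum_congr rfl fun j _ => h1 j, Finset.sum_add_distrib, sum_mul_expForm_eq hz,
    Matrix.mulVec_mulVec, charMatrix_mul_greenCoeff hdet, Matrix.neg_mulVec, ← Finset.sum_mul]
  simp [Matrix.mulVec, dotProduct]

/-- The Green function of `(-i)^n D^n - z^n` on the diagonal. -/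
theorem greenFunction_diagonal_eq (hn : 2 ≤ n) (hab : a < b) (hz : z ≠ 0)
    (hP : ∀ j, (P j).natDegree < n) (hQ : ∀ j, (Q j).natDegree < n)
    (hdet : (charMatrix a b P Q ν z).det ≠ 0) {x : ℝ} (hx : x ∈ Icc a b) :
    greenFunction n a b P Q x x (z ^ n) =
      (-∑ j : Fin n, if (j : ℕ) < ν then 0 else fundCoeff n z j) +
      ∑ j, ∑ k, greenCoeff a b P Q ν z j k * fundCoeff n z k *
        Complex.exp ((exponent n z j - exponent n z k) * x +
          (exponent n z k * farEnd a b ν k - exponent n z j * nearEnd a b ν j)) := by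
  have hG := isGreenFunction_greenCandidate hn hab hz hP hQ
    (fun j => continuous_regularCoeff (a := a) (b := b) (P := P) (Q := Q) (ν := ν) (z := z) j)
    fun ξ _ r => boundary_regularCoeff hz hdet ξ r
  -- The choice operator returns an actual Green function since the explicit candidate is one.
  have hE : IsGreenFunction n a b P Q (z ^ n)
      (Classical.epsilon (IsGreenFunction n a b P Q (z ^ n))) := Classical.epsilon_spec ⟨_, hG⟩
  have heq : EqOn (fun x => greenFunction n a b P Q x x (z ^ n)) (fun x : ℝ =>
      (-∑ j : Fin n, if (j : ℕ) < ν then 0 else fundCoeff n z j) +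
      ∑ j, ∑ k, greenCoeff a b P Q ν z j k * fundCoeff n z k *
        Complex.exp ((exponent n z j - exponent n z k) * x +
          (exponent n z k * farEnd a b ν k - exponent n z j * nearEnd a b ν j))) (Ioo a b) := by
    intro x hx
    simp only
    rw [greenFunction, hE.eq_of_injective hn hab hz hP hQ
      (eq_zero_of_det_charMatrix_ne_zero hz hdet) hG hx, greenCandidate_of_ge le_rfl, sub_self,
      fundSol_zero (by omega), zero_add, ← Finset.sum_neg_distrib, ← Finset.sum_add_distrib]
    refine Finset.sum_congr rfl fun j _ => ?_
    rw [pow_zero, mul_one, regularCoeff, add_mul, mul_assoc (∑ k, _), Finset.sum_mul]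
    congr 1
    · split_ifs
      · simp
      · rw [neg_mul, mul_assoc, ← Complex.exp_add, neg_add_cancel, Complex.exp_zero, mul_one]
    · refine Finset.sum_congr rfl fun k _ => ?_
      rw [← Complex.exp_add, mul_assoc, mul_assoc, mul_assoc, ← Complex.exp_add]
      ring_nf
  -- Uniqueness covers interior points; the end points follow from joint continuity.
  refine heq.of_subset_closure ?_ ?_ Ioo_subset_Icc_self (closure_Ioo hab.ne).ge hx
  · have h1 := hE.continuousOn 0 (Nat.zero_le _)
    simp only [iteratedDerivWithin_zero] at h1
    exact h1.comp (f := fun x : ℝ => (x, x)) (by fun_prop) fun x hx => ⟨hx, hx⟩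
  · fun_prop

end Diagonal

end TraceFormula

namespace TraceFormula

/-! ### Decay of the diagonal of the Green function -/

section Decay

variable {n : ℕ} {a b : ℝ} {P Q : Fin n → ℂ[X]} {ν : ℕ} {z : ℂ}

/-- The exponential is the product of `exp (κ_j (x - near_j))` and `exp (κ_k (far_k - x))`, both of
modulus at most `1`. As `j ≠ k`, at least one index differs from `k₀`, and its factor decays at rate
`c ‖z‖` away from `a` or from `b`. -/
lemma HasDichotomy.norm_exp_le {c : ℝ} {k₀ : Fin n}
    (h : HasDichotomy n ν c z k₀) {j k : Fin n} (hjk : j ≠ k) :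
    (∀ x ∈ Icc a b, ‖Complex.exp ((exponent n z j - exponent n z k) * x +
          (exponent n z k * farEnd a b ν k - exponent n z j * nearEnd a b ν j))‖ ≤
        Real.exp (-(c * ‖z‖) * (x - a))) ∨
      ∀ x ∈ Icc a b, ‖Complex.exp ((exponent n z j - exponent n z k) * x +
          (exponent n z k * farEnd a b ν k - exponent n z j * nearEnd a b ν j))‖ ≤
        Real.exp (-(c * ‖z‖) * (b - x)) := by
  have hnorm : ∀ x : ℝ, ‖Complex.exp ((exponent n z j - exponent n z k) * x +
          (exponent n z k * farEnd a b ν k - exponent n z j * nearEnd a b ν j))‖ =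
      Real.exp ((exponent n z j).re * (x - nearEnd a b ν j) +
        (exponent n z k).re * (farEnd a b ν k - x)) := by
    intro x
    rw [Complex.norm_exp]
    simp only [Complex.add_re, Complex.sub_re, Complex.re_mul_ofReal]
    ring_nf
  have hj : ∀ x ∈ Icc a b, (exponent n z j).re * (x - nearEnd a b ν j) ≤ 0 := by
    intro x hx
    rw [nearEnd]
    split_ifs with hν
    · exact mul_nonpos_of_nonpos_of_nonneg (h.re_nonpos j hν) (sub_nonneg.2 hx.1)
    · exact mul_nonpos_of_nonneg_of_nonpos (h.re_nonneg j (not_lt.1 hν)) (sub_nonpos.2 hx.2)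
  have hk : ∀ x ∈ Icc a b, (exponent n z k).re * (farEnd a b ν k - x) ≤ 0 := by
    intro x hx
    rw [farEnd]
    split_ifs with hν
    · exact mul_nonpos_of_nonpos_of_nonneg (h.re_nonpos k hν) (sub_nonneg.2 hx.2)
    · exact mul_nonpos_of_nonneg_of_nonpos (h.re_nonneg k (not_lt.1 hν)) (sub_nonpos.2 hx.1)
  simp only [hnorm, Real.exp_le_exp]
  by_cases hj0 : j = k₀
  · have hgap := h.gap k fun hk0 => hjk (hj0.trans hk0.symm)
    by_cases hν : (k : ℕ) < ν
    · refine Or.inr fun x hx => (add_le_of_nonpos_left (hj x hx)).trans ?_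
      rw [abs_of_nonpos (h.re_nonpos k hν)] at hgap
      rw [farEnd, if_pos hν]
      exact mul_le_mul_of_nonneg_right (by linarith) (sub_nonneg.2 hx.2)
    · refine Or.inl fun x hx => (add_le_of_nonpos_left (hj x hx)).trans ?_
      rw [abs_of_nonneg (h.re_nonneg k (not_lt.1 hν))] at hgap
      rw [farEnd, if_neg hν]
      linarith [mul_le_mul_of_nonneg_right hgap (sub_nonneg.2 hx.1)]
  · have hgap := h.gap j hj0
    by_cases hν : (j : ℕ) < ν
    · refine Or.inl fun x hx => (add_le_of_nonpos_right (hk x hx)).trans ?_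
      rw [abs_of_nonpos (h.re_nonpos j hν)] at hgap
      rw [nearEnd, if_pos hν]
      exact mul_le_mul_of_nonneg_right (by linarith) (sub_nonneg.2 hx.1)
    · refine Or.inr fun x hx => (add_le_of_nonpos_right (hk x hx)).trans ?_
      rw [abs_of_nonneg (h.re_nonneg j (not_lt.1 hν))] at hgap
      rw [nearEnd, if_neg hν]
      linarith [mul_le_mul_of_nonneg_right hgap (sub_nonneg.2 hx.2)]

lemma norm_fundCoeff_mul_pow (hz : z ≠ 0) (k : Fin n) :
    ‖fundCoeff n z k‖ * ‖z‖ ^ n = ‖z‖ / n := by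
  have hn : (n : ℝ) ≠ 0 := by
    have : n ≠ 0 := fun h => by subst h; exact k.elim0
    exact_mod_cast this
  have hz' : ‖z‖ ≠ 0 := norm_ne_zero_iff.2 hz
  simp only [fundCoeff, norm_div, norm_mul, norm_inv, norm_pow, norm_neg, Complex.norm_I, one_pow,
    inv_one, one_mul, norm_exponent, Complex.norm_natCast]
  field_simp

lemma norm_sourceMatrix_apply (r k : Fin n) :
    ‖sourceMatrix P Q ν z r k‖ = ‖(if (k : ℕ) < ν then Q r else P r).eval (exponent n z k) /
      (Complex.I * z) ^ bcOrder (P r) (Q r)‖ := by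
  rw [sourceMatrix, Matrix.of_apply, norm_mul]
  split_ifs <;> simp

lemma complexIntegral_greenFunction_diagonal (hn : 2 ≤ n) (hab : a < b) (hz : z ≠ 0)
    (hP : ∀ j, (P j).natDegree < n) (hQ : ∀ j, (Q j).natDegree < n)
    (hdet : (charMatrix a b P Q ν z).det ≠ 0) (q : ComplexMeasure (Icc a b)) (hq : q univ = 0) :
    complexIntegral q (fun x => greenFunction n a b P Q x x (z ^ n)) =
      ∑ j, ∑ k, greenCoeff a b P Q ν z j k * fundCoeff n z k *
        complexIntegral q fun x => Complex.exp ((exponent n z j - exponent n z k) * (x : ℝ) +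
          (exponent n z k * farEnd a b ν k - exponent n z j * nearEnd a b ν j)) := by
  have hint : ∀ f : Icc a b → ℂ, Continuous f → Integrable f (∑ i, measurePart q i) := fun f hf =>
    hf.integrable_of_hasCompactSupport (HasCompactSupport.of_compactSpace _)
  have hint' : ∀ f : Icc a b → ℂ, Continuous f → Integrable f q.variation := fun f hf =>
    hf.integrable_of_hasCompactSupport (HasCompactSupport.of_compactSpace _)
  have h1 : (fun x : Icc a b => greenFunction n a b P Q x x (z ^ n)) =
      (fun _ => -∑ j : Fin n, if (j : ℕ) < ν then 0 else fundCoeff n z j) +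
      fun x : Icc a b => ∑ j, ∑ k, greenCoeff a b P Q ν z j k * fundCoeff n z k *
        Complex.exp ((exponent n z j - exponent n z k) * (x : ℝ) +
          (exponent n z k * farEnd a b ν k - exponent n z j * nearEnd a b ν j)) :=
    funext fun x => greenFunction_diagonal_eq hn hab hz hP hQ hdet x.2
  rw [h1, complexIntegral_add q (hint' _ continuous_const) (hint' _ (by fun_prop)),
    complexIntegral_const q hq, zero_add, complexIntegral,
    VectorMeasure.integral_finsetSum _ fun j _ => hint' _ (by fun_prop)]
  refine Finset.sum_congr rfl fun j _ => ?_
  rw [VectorMeasure.integral_finsetSum _ fun k _ => hint' _ (by fun_prop)]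
  refine Finset.sum_congr rfl fun k _ => ?_
  exact complexIntegral_const_mul q _ (hint _ (by fun_prop))

/-- Away from the eigenvalues, the integral of the diagonal of the Green function is
`o(|z| ^ (-n))`. -/
theorem exists_norm_pow_mul_norm_complexIntegral_greenFunction_le (hn : 2 ≤ n) (hab : a < b)
    (hP : ∀ j, (P j).natDegree < n) (hQ : ∀ j, (Q j).natDegree < n)
    (hθ : (birkhoffMatrix P Q ν).det ≠ 0) (q : ComplexMeasure (Icc a b)) (hq : q univ = 0)
    (hqa : q {t | (t : ℝ) = a} = 0)
    (hQa : HasDerivWithinAt (distributionFunction q) 0 (Icc a b) a)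
    (hQb : HasDerivWithinAt (distributionFunction q) 0 (Icc a b) b)
    {c δ ε : ℝ} (hc : 0 < c) (hδ : 0 < δ) (hε : 0 < ε) :
    ∃ R₀ > 0, ∀ z : ℂ, R₀ ≤ ‖z‖ → ∀ k₀, HasDichotomy n ν c z k₀ →
      (∀ w ∈ Metric.closedBall z δ, w ^ n ∉ eigenvalues n a b 0 P Q) →
      ‖z‖ ^ n * ‖complexIntegral q fun x => greenFunction n a b P Q x x (z ^ n)‖ ≤ ε := by
  obtain ⟨η, hη, R₁, -, hR₁⟩ := exists_le_norm_det_charMatrix hab P Q hθ hc hδ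
  obtain ⟨C, hC, R₂, -, hR₂⟩ := exists_charMatrix_entry_bound hab.le P Q ν
  obtain ⟨C', hC', hinv⟩ := exists_norm_inv_le (n := n) C hη
  have hn0 : (0 : ℝ) < n := by exact_mod_cast (by omega : 0 < n)
  obtain ⟨R₃, -, hR₃⟩ := exists_mul_norm_complexIntegral_exp_le hab.le q hq hqa hQa hQb hc
    -- There are `n²` terms; in each the coefficient bound `n C' C` meets `‖c_k‖ ‖z‖ ^ n = ‖z‖ / n`,
    -- which leaves `C' C ‖z‖` times the moment.
    (ε := ε / (n * n * (C' * C))) (by positivity)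
  refine ⟨max (max R₁ R₂) (max R₃ (δ + 1)), by positivity, fun z hz k₀ hdic hsep => ?_⟩
  have hz1 : R₁ ≤ ‖z‖ := (le_max_left _ _).trans ((le_max_left _ _).trans hz)
  have hz2 : R₂ ≤ ‖z‖ := (le_max_right _ _).trans ((le_max_left _ _).trans hz)
  have hz3 : R₃ ≤ ‖z‖ := (le_max_left _ _).trans ((le_max_right _ _).trans hz)
  have hz4 : δ + 1 ≤ ‖z‖ := (le_max_right _ _).trans ((le_max_right _ _).trans hz)
  have hz0 : z ≠ 0 := norm_pos_iff.1 (by linarith)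
  have hdet : ∀ w ∈ Metric.closedBall z δ, (charMatrix a b P Q ν w).det ≠ 0 := by
    intro w hw h0
    have hw0 : w ≠ 0 := by
      rintro rfl
      rw [mem_closedBall_iff_norm', sub_zero] at hw
      linarith
    exact hsep w hw (mem_eigenvalues_of_det_charMatrix_eq_zero hab hw0 hP hQ h0)
  have hcoeff : ∀ j k, ‖greenCoeff a b P Q ν z j k‖ ≤ n * (C' * C) := by
    intro j k
    rw [greenCoeff, Matrix.neg_apply, norm_neg, Matrix.mul_apply]
    calc ‖∑ r, (charMatrix a b P Q ν z)⁻¹ j r * sourceMatrix P Q ν z r k‖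
        ≤ ∑ _r : Fin n, C' * C := by
          refine norm_sum_le_of_le _ fun r _ => ?_
          rw [norm_mul]
          refine mul_le_mul ?_ ?_ (norm_nonneg _) hC'.le
          · exact hinv _ (fun r k => (hR₂ z hz2 c k₀ hdic r k).1) (hR₁ z hz1 k₀ hdic hdet) j r
          · rw [norm_sourceMatrix_apply]
            exact (hR₂ z hz2 c k₀ hdic r k).2
      _ = n * (C' * C) := by simp
  rw [complexIntegral_greenFunction_diagonal hn hab hz0 hP hQ
    (hdet z (Metric.mem_closedBall_self hδ.le)) q hq]
  have hterm : ∀ j k, ‖greenCoeff a b P Q ν z j k * fundCoeff n z k *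
        complexIntegral q fun x => Complex.exp ((exponent n z j - exponent n z k) * (x : ℝ) +
          (exponent n z k * farEnd a b ν k - exponent n z j * nearEnd a b ν j))‖ ≤
      ε / (n * n) / ‖z‖ ^ n := by
    intro j k
    by_cases hjk : j = k
    -- For `j = k` the exponential does not depend on `x`, and `q` has total mass zero.
    · subst hjk
      simp only [sub_self, zero_mul, zero_add]
      rw [complexIntegral_const q hq, mul_zero, norm_zero]
      positivity
    · have h1 := hR₃ ‖z‖ hz3 (exponent n z j - exponent n z k)
        (exponent n z k * farEnd a b ν k - exponent n z j * nearEnd a b ν j)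
        ((norm_sub_le _ _).trans (by rw [norm_exponent, norm_exponent]; linarith))
        (hdic.norm_exp_le hjk)
      set t := ‖complexIntegral q fun x => Complex.exp
        ((exponent n z j - exponent n z k) * (x : ℝ) +
          (exponent n z k * farEnd a b ν k - exponent n z j * nearEnd a b ν j))‖
      have hzn : 0 < ‖z‖ ^ n := pow_pos (norm_pos_iff.2 hz0) n
      rw [le_div_iff₀ hzn, norm_mul, norm_mul]
      calc ‖greenCoeff a b P Q ν z j k‖ * ‖fundCoeff n z k‖ * t * ‖z‖ ^ n
          = ‖greenCoeff a b P Q ν z j k‖ * ((‖fundCoeff n z k‖ * ‖z‖ ^ n) * t) := by ring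
        _ ≤ n * (C' * C) * ((‖fundCoeff n z k‖ * ‖z‖ ^ n) * t) :=
          mul_le_mul_of_nonneg_right (hcoeff j k) (by positivity)
        _ = C' * C * (‖z‖ * t) := by rw [norm_fundCoeff_mul_pow hz0]; field_simp
        _ ≤ C' * C * (ε / (n * n * (C' * C))) := by gcongr
        _ = ε / (n * n) := by field_simp
  have hsum : ‖∑ j, ∑ k, greenCoeff a b P Q ν z j k * fundCoeff n z k *
        complexIntegral q fun x => Complex.exp ((exponent n z j - exponent n z k) * (x : ℝ) +
          (exponent n z k * farEnd a b ν k - exponent n z j * nearEnd a b ν j))‖ ≤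
      ∑ _j : Fin n, ∑ _k : Fin n, ε / (n * n) / ‖z‖ ^ n :=
    norm_sum_le_of_le _ fun j _ => norm_sum_le_of_le _ fun k _ => hterm j k
  have hzn : ‖z‖ ^ n ≠ 0 := pow_ne_zero _ (norm_ne_zero_iff.2 hz0)
  calc _ ≤ ‖z‖ ^ n * ∑ _j : Fin n, ∑ _k : Fin n, ε / (n * n) / ‖z‖ ^ n :=
        mul_le_mul_of_nonneg_left hsum (by positivity)
    _ = ε := by
      simp only [Finset.sum_const, Finset.card_univ, Fintype.card_fin, nsmul_eq_mul]
      field_simp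

end Decay

/-! ### The contours -/

/-- The derivative of `(R e^{iφ}) ^ n` is `n (R e^{iφ}) ^ (n - 1) (R' + i R) e^{iφ}`, and `|R'| ≤ c
R`. -/
lemma norm_derivWithin_contour_le {n : ℕ} (hn : n ≠ 0) {R : ℝ → ℝ}
    (hR : DifferentiableOn ℝ R (Icc 0 (2 * Real.pi / n))) {c φ : ℝ}
    (hφ : φ ∈ Icc 0 (2 * Real.pi / n)) (hpos : 0 < R φ)
    (hs : |derivWithin R (Icc 0 (2 * Real.pi / n)) φ| ≤ c * R φ) :
    ‖derivWithin (contour n R) (Icc 0 (2 * Real.pi / n)) φ‖ ≤ n * (c + 1) * R φ ^ n := by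
  have hn0 : (0 : ℝ) < n := by exact_mod_cast Nat.pos_of_ne_zero hn
  have huniq := uniqueDiffOn_Icc (show (0 : ℝ) < 2 * Real.pi / n by positivity) φ hφ
  set s := Icc 0 (2 * Real.pi / n)
  have h1 : HasDerivWithinAt (fun φ => (R φ : ℂ)) ((derivWithin R s φ : ℝ) : ℂ) s φ :=
    (hR φ hφ).hasDerivWithinAt.ofReal_comp
  have h2 : HasDerivWithinAt (fun φ : ℝ => Complex.exp (φ * Complex.I))
      (Complex.exp (φ * Complex.I) * Complex.I) s φ := by
    have h := ((hasDerivAt_id (φ : ℂ)).mul_const Complex.I).cexp.comp_ofReal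
    simp only [id, one_mul] at h
    exact h.hasDerivWithinAt
  have h3 := (h1.mul h2).pow n
  have h4 : derivWithin (contour n R) s φ = _ := h3.derivWithin huniq
  have hexp : ‖Complex.exp (φ * Complex.I)‖ = 1 := Complex.norm_exp_ofReal_mul_I φ
  rw [h4]
  simp only [Pi.mul_apply]
  rw [norm_mul, norm_mul, norm_pow, norm_mul, hexp, Complex.norm_natCast, Complex.norm_real,
    Real.norm_of_nonneg hpos.le, mul_one]
  have h5 : ‖((derivWithin R s φ : ℝ) : ℂ) * Complex.exp (φ * Complex.I) +
      (R φ : ℂ) * (Complex.exp (φ * Complex.I) * Complex.I)‖ ≤ c * R φ + R φ := by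
    refine norm_add_le_of_le ?_ ?_
    · rwa [norm_mul, hexp, mul_one, Complex.norm_real]
    · rw [norm_mul, norm_mul, hexp, Complex.norm_I, mul_one, mul_one, Complex.norm_real,
        Real.norm_of_nonneg hpos.le]
  calc _ ≤ n * R φ ^ (n - 1) * (c * R φ + R φ) := by gcongr
    _ = n * (c + 1) * (R φ ^ (n - 1) * R φ) := by ring
    _ = _ := by rw [pow_sub_one_mul hn]

lemma IsAcceptable.eventually_le {n : ℕ} {S : Set ℂ} {R : ℕ → ℝ → ℝ} (hR : IsAcceptable n S R)
    (R₀ : ℝ) : ∀ᶠ ℓ in atTop, ∀ φ ∈ Icc 0 (2 * Real.pi / n), R₀ ≤ R ℓ φ := by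
  obtain ⟨c₁, -, hosc⟩ := hR.oscillation
  filter_upwards [hR.tendsto.eventually_ge_atTop (R₀ + c₁)] with ℓ hℓ φ hφ
  have := (abs_le.1 (hosc ℓ φ hφ)).1
  linarith

end TraceFormula

/-! ### The limit of the contour integrals -/

theorem theorem1p5 (n : ℕ) (hn : 3 ≤ n) (hodd : Odd n) (a b : ℝ) (hab : a < b)
    (p : Fin (n - 1) → ℝ → ℂ) (hp : ∀ k, IntegrableOn (p k) (Icc a b))
    (P Q : Fin n → ℂ[X])
    (hP : ∀ j, (P j).natDegree < n) (hQ : ∀ j, (Q j).natDegree < n)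
    (hnorm : TraceFormula.IsNormalized P Q) (hreg : TraceFormula.IsBirkhoffRegular P Q)
    (q : ComplexMeasure (Icc a b))
    (hq : q univ = 0)
    (hqa : q {t | (t : ℝ) = a} = 0) (hqb : q {t | (t : ℝ) = b} = 0)
    (hQa : HasDerivWithinAt (TraceFormula.distributionFunction q) 0 (Icc a b) a)
    (hQb : HasDerivWithinAt (TraceFormula.distributionFunction q) 0 (Icc a b) b)
    (R : ℕ → ℝ → ℝ)
    (hR : TraceFormula.IsAcceptable n
      (TraceFormula.eigenvalues n a b 0 P Q ∪ TraceFormula.eigenvalues n a b p P Q) R) :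
    Tendsto
      (fun ℓ => TraceFormula.contourIntegral n (R ℓ) fun μ =>
        TraceFormula.complexIntegral q fun x => TraceFormula.greenFunction n a b P Q x x μ)
      atTop (𝓝 0) := by
  have hπ := Real.pi_pos
  have hn0 : (0 : ℝ) < n := by exact_mod_cast (by omega : 0 < n)
  have hL : 0 ≤ 2 * Real.pi / n := by positivity
  obtain ⟨c₂, hc₂, hslope⟩ := hR.slope
  obtain ⟨δ, hδ, hsep⟩ := hR.exists_separation hn
  have hc : 0 < Real.sin (Real.pi / (2 * n)) := by
    refine Real.sin_pos_of_pos_of_lt_pi (by positivity) ?_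
    rw [div_lt_iff₀ (by positivity)]
    have : (3 : ℝ) ≤ n := by exact_mod_cast hn
    nlinarith
  rw [NormedAddGroup.tendsto_nhds_zero]
  intro ε hε
  have hK : 0 < n * (c₂ + 1) * (2 * Real.pi / n + 1) := by positivity
  -- The powers `R ^ n` of the speed and `R ^ (-n)` of the integrand cancel, so the integrand is at
  -- most `n (c₂ + 1) ε'` on an interval of length `2π/n`.
  set ε' := ε / 2 / (n * (c₂ + 1) * (2 * Real.pi / n + 1)) with hε'
  have hε'0 : 0 < ε' := by positivity
  obtain ⟨R₁, -, hR₁⟩ :=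
    TraceFormula.exists_norm_pow_mul_norm_complexIntegral_greenFunction_le (by omega) hab hP hQ
      hreg.1 q hq hqa hQa hQb hc hδ hε'0
  obtain ⟨R₂, -, hR₂⟩ :=
    TraceFormula.exists_norm_pow_mul_norm_complexIntegral_greenFunction_le (by omega) hab hP hQ
      hreg.2 q hq hqa hQa hQb hc hδ hε'0
  filter_upwards [hsep, hR.eventually_le (max R₁ R₂)] with ℓ hsepℓ hleℓ
  have hbound : ∀ φ ∈ uIoc 0 (2 * Real.pi / n),
      ‖(TraceFormula.complexIntegral q fun x => TraceFormula.greenFunction n a b P Q x x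
          (TraceFormula.contour n (R ℓ) φ)) *
        derivWithin (TraceFormula.contour n (R ℓ)) (Icc 0 (2 * Real.pi / n)) φ‖ ≤
      n * (c₂ + 1) * ε' := by
    intro φ hφ'
    have hφ : φ ∈ Icc 0 (2 * Real.pi / n) := by
      rw [uIoc_of_le hL] at hφ'
      exact Ioc_subset_Icc_self hφ'
    have hpos := hR.pos ℓ φ hφ
    have hder := TraceFormula.norm_derivWithin_contour_le (by omega)
      ((hR.smooth ℓ).differentiableOn one_ne_zero) hφ hpos (hslope ℓ φ hφ)
    set z : ℂ := (R ℓ φ : ℂ) * Complex.exp (φ * Complex.I) with hz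
    have hnz : ‖z‖ = R ℓ φ := by
      rw [hz, norm_mul, Complex.norm_exp_ofReal_mul_I, mul_one, Complex.norm_real,
        Real.norm_of_nonneg hpos.le]
    have hnot : ∀ w ∈ Metric.closedBall z δ, w ^ n ∉ TraceFormula.eigenvalues n a b 0 P Q := by
      intro w hw hmem
      exact (hsepℓ φ hφ w (Or.inl hmem)).not_ge (mem_closedBall_iff_norm.1 hw)
    have hint : R ℓ φ ^ n * ‖TraceFormula.complexIntegral q fun x =>
        TraceFormula.greenFunction n a b P Q x x (z ^ n)‖ ≤ ε' := by
      rw [← hnz]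
      -- Which of the two regularity determinants matters depends on the half of the sector
      -- containing `z`; the radius exceeds both thresholds.
      obtain ⟨ν, rfl | rfl, k₀, hdic⟩ := TraceFormula.exists_hasDichotomy hn hodd hpos.le hφ
      · exact hR₁ z (hnz ▸ (le_max_left _ _).trans (hleℓ φ hφ)) k₀ hdic hnot
      · exact hR₂ z (hnz ▸ (le_max_right _ _).trans (hleℓ φ hφ)) k₀ hdic hnot
    rw [norm_mul]
    calc _ ≤ ‖TraceFormula.complexIntegral q fun x =>
            TraceFormula.greenFunction n a b P Q x x (z ^ n)‖ *
          (n * (c₂ + 1) * R ℓ φ ^ n) := mul_le_mul_of_nonneg_left hder (norm_nonneg _)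
      _ = n * (c₂ + 1) * (R ℓ φ ^ n * ‖TraceFormula.complexIntegral q fun x =>
            TraceFormula.greenFunction n a b P Q x x (z ^ n)‖) := by ring
      _ ≤ _ := by gcongr
  have hfin := intervalIntegral.norm_integral_le_of_norm_le_const hbound
  rw [sub_zero, abs_of_nonneg hL] at hfin
  refine hfin.trans_lt ?_
  calc n * (c₂ + 1) * ε' * (2 * Real.pi / n)
      ≤ n * (c₂ + 1) * ε' * (2 * Real.pi / n + 1) := by gcongr; linarith
    _ = ε / 2 := by rw [hε']; field_simp
    _ < ε := by linarith
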